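/- **Setting.** Let $(\mathcal S,\mathcal A,p,r_{\mathrm{rew}})$ be a Markov decision process with measurable state and action spaces, transition law $p(\cdot\mid s,a)$, reward $r_{\mathrm{rew}}$ and discount factor $\gamma\in[0,1)$. Let $\pi_\theta(a\mid s)>0$, $\theta\in\mathbb R^d$, be a family of policy densities with respect to a $\sigma$-finite measure on $\mathcal A$. Let $V^{\pi_\theta}(s)=\mathbb E[\sum_{t\ge1}\gamma^{t-1}r_{\mathrm{rew}}(s_t,a_t)\mid s_1=s;\pi_\theta]$, let $Q^{\pi_\theta}(s,a)$ be the same expectation given $s_1=s,a_1=a$, and let $g(s,a\mid\theta)=(Q^{\pi_\theta}(s,a)-V^{\pi_\theta}(s))\,\nabla_\theta\log\pi_\theta(a\mid s)$. Assume, with positive constants: (A.1) $|r_{\mathrm{rew}}|\le U_r$; $\theta\mapsto\pi_\theta(a\mid s)$ is differentiable; for all $s,a,\theta,\theta_1,\theta_2$: $\|\nabla\log\pi_{\theta_1}(a|s)-\nabla\log\pi_{\theta_2}(a|s)\|\le L_\Theta\|\theta_1-\theta_2\|$, $\|\nabla\log\pi_\theta(a|s)\|\le U_\Theta$, $\|\pi_{\theta_1}(\cdot|s)-\pi_{\theta_2}(\cdot|s)\|_{TV}\le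 U_\pi\|\theta_1-\theta_2\|$. (A.2) For each $\theta$ the state chain under $\pi_\theta$ has a stationary distribution $d^{\pi_\theta}$, and $\|\mathbb P(s_t\in\cdot\mid s_1=s)-d^{\pi_\theta}\|_{TV}\le\varphi(t):=\kappa_0\kappa^t$ for all $t\ge1$ and all $s,\theta$, where $\kappa_0>0$ and $\kappa\in(0,1)$ do not depend on $\theta$. Let $J:\mathbb R^d\to\mathbb R$ be the objective: $|J|\le U_J$ and its gradient is the policy gradient $\nabla J(\theta)=\mathbb E_{s\sim d^{\pi_\theta},\,a\sim\pi_\theta(\cdot|s)}[g(s,a\mid\theta)]$. **Algorithm (PG-VRER).** Let $n\ge1$, $c>1$, $U_f>0$, $r\in(0,1)$, $\eta_1>0$, and let $(B_k)$ be a nondecreasing sequence of positive integers (the buffer sizes). In iteration $k=1,2,\dots$ one draws $n$ further steps $(s^{(k,j)},a^{(k,j)})_{j\le n}$ of a single trajectory of the decision process, using the policy $\pi_{\theta_k}$ in iteration $k$ and continuing from the state reached in the previous iteration. Parameters and samples available beforehand carry indices $i\le0$ (there may be none). For $f_{i,k}(s,a)=\pi_{\theta_k}(a|s)/\pi_{\theta_i}(a|s)$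 put $$\widehat\nabla J^{R}_{i,k}=\frac1n\sum_{j=1}^n w\bigl(f_{i,k}(s^{(i,j)},a^{(i,j)})\bigr)\,g(s^{(i,j)},a^{(i,j)}\mid\theta_k),\qquad \widehat\nabla J^{PG}_k=\frac1n\sum_{j=1}^n g(s^{(k,j)},a^{(k,j)}\mid\theta_k),$$ where $w(f)=f$ for $R=LR$ and $w(f)=\min(f,U_f)$ for $R=CLR$. The reuse set $\mathcal U_k$ consists of those of the available indices $i\in(k-B_k,k]$ for which $\mathrm{Tr}\,\mathrm{Var}[\widehat\nabla J^R_{i,k}]\le c\,\mathrm{Tr}\,\mathrm{Var}[\widehat\nabla J^{PG}_k]$, and $$\theta_{k+1}=\theta_k+\eta_k\,\frac1{|\mathcal U_k|}\sum_{i\in\mathcal U_k}\widehat\nabla J^R_{i,k},\qquad \eta_k=\eta_1k^{-r}.$$ For $R=LR$ assume in addition the bounded likelihood ratio $\pi_{\theta_1}(a|s)/\pi_{\theta_2}(a|s)\le U_f$ for all $\theta_1,\theta_2,s,a$. **Claim.** $\nabla J$ is Lipschitz continuous, with a constant that depends only on the constants in the assumptions. Let $L>0$ be any Lipschitz constant of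 $\nabla J$, let $\eta_1\in(0,\frac1{4L}]$, and set $t^\star_K=\log_\kappa K^{-r/n}$, so that $\varphi(nt^\star_K)=\kappa_0K^{-r}$. There is a constant $C$, depending only on $n,\gamma,U_r,U_\Theta,L_\Theta,U_\pi,\kappa_0,\kappa,U_J,U_f,c,r,L,\eta_1$ (not on the decision process, the policies, the run or the buffer sizes), such that for both kinds of estimators and all $K\ge1$ $$\frac1K\sum_{k=1}^K\mathbb E\bigl[\|\nabla J(\theta_k)\|^2\bigr]\le C\left(\frac1{K^{1-r}}+\frac{(t^\star_K)^2}{K^r}+\frac{B_K+t^\star_K}{K^r}\right).$$ Consequently, if $B_K/K^r\to0$, then $\frac1K\sum_{k=1}^K\mathbb E[\|\nabla J(\theta_k)\|^2]\to0$. -/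

import Mathlib

open MeasureTheory ProbabilityTheory Filter Topology
open scoped ENNReal NNReal

universe u v w

namespace VRER

/-- The space `ℝᵈ` of policy parameters, with its Euclidean norm. -/
abbrev Param (d : ℕ) : Type := EuclideanSpace ℝ (Fin d)

/-- Total variation distance `sup_D |μ(D) - ν(D)|` over measurable `D` (for finite measures). -/
noncomputable def tvDist {α : Type*} [MeasurableSpace α] (μ ν : Measure α) : ℝ :=
  ⨆ D : {D : Set α // MeasurableSet D}, |μ.real D.1 - ν.real D.1|

/-- Total variance `Tr (Var Z)` of a random vector: the sum of the variances of its coordinates. -/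
noncomputable def totalVariance {Ω : Type*} [MeasurableSpace Ω] {d : ℕ}
    (Z : Ω → Param d) (μ : Measure Ω) : ℝ :=
  ∑ l, Var[fun ω => Z ω l; μ]

/-- A Markov decision process (transition law `trans`, reward `reward`) together with a family of
stochastic policies, parametrised by `θ ∈ ℝᵈ` and given by strictly positive probability densities
`dens θ s a = π_θ(a|s)` with respect to a reference measure on the actions. -/
structure MDP (d : ℕ) (S A : Type*) [MeasurableSpace S] [MeasurableSpace A] where
  trans : Kernel (S × A) S
  isMarkov : IsMarkovKernel trans
  reward : S × A → ℝ
  measurable_reward : Measurable reward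
  actionRef : Measure A
  sigmaFinite : SigmaFinite actionRef
  dens : Param d → S → A → ℝ
  measurable_dens : Measurable fun z : Param d × S × A => dens z.1 z.2.1 z.2.2
  dens_pos : ∀ θ s a, 0 < dens θ s a
  lintegral_dens : ∀ θ s, ∫⁻ a, ENNReal.ofReal (dens θ s a) ∂actionRef = 1

namespace MDP

variable {d : ℕ} {S A : Type*} [MeasurableSpace S] [MeasurableSpace A]

attribute [instance] isMarkov sigmaFinite

/-- The policy `π_θ(·|s)` as a kernel from states to actions. -/
noncomputable def policy (M : MDP d S A) (θ : Param d) : Kernel S A :=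
  Kernel.withDensity (Kernel.const S M.actionRef) fun s a => ((M.dens θ s a).toNNReal : ℝ≥0∞)

theorem policy_apply (M : MDP d S A) (θ : Param d) (s : S) :
    M.policy θ s = M.actionRef.withDensity fun a => ENNReal.ofReal (M.dens θ s a) := by
  unfold policy
  rw [Kernel.withDensity_apply]
  · rfl
  · have h : Measurable fun z : S × A => M.dens θ z.1 z.2 :=
      M.measurable_dens.comp (measurable_const.prodMk measurable_id)
    exact h.real_toNNReal.coe_nnreal_ennreal

instance (M : MDP d S A) (θ : Param d) : IsMarkovKernel (M.policy θ) :=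
  ⟨fun s => ⟨by
    rw [policy_apply, withDensity_apply _ MeasurableSet.univ, Measure.restrict_univ,
      M.lintegral_dens]⟩⟩

/-- From a state `s`, the law of `(s, a)` with `a ∼ π_θ(·|s)`. -/
noncomputable def act (M : MDP d S A) (θ : Param d) : Kernel S (S × A) :=
  Kernel.id ×ₖ M.policy θ

/-- One step of the state chain under the fixed policy `π_θ`. -/
noncomputable def stateKernel (M : MDP d S A) (θ : Param d) : Kernel S S :=
  M.trans ∘ₖ M.act θ

/-- One step of the state-action chain under the fixed policy `π_θ`. -/
noncomputable def pairKernel (M : MDP d S A) (θ : Param d) : Kernel (S × A) (S × A) :=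
  M.act θ ∘ₖ M.trans

/-- Action-value function: `∑ₜ γᵗ E[r(s_{t+1}, a_{t+1}) | (s₁, a₁) = x]` under `π_θ`. -/
noncomputable def Q (M : MDP d S A) (γ : ℝ) (θ : Param d) (x : S × A) : ℝ :=
  ∑' t : ℕ, γ ^ t * ∫ y, M.reward y ∂((M.pairKernel θ ^ t) x)

/-- State-value function: `∑ₜ γᵗ E[r(s_{t+1}, a_{t+1}) | s₁ = s]` under `π_θ`. -/
noncomputable def V (M : MDP d S A) (γ : ℝ) (θ : Param d) (s : S) : ℝ :=
  ∑' t : ℕ, γ ^ t * ∫ y, M.reward y ∂(((M.pairKernel θ ^ t) ∘ₖ M.act θ) s)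

/-- The score `∇_θ log π_θ(a|s)` at `x = (s, a)`. -/
noncomputable def score (M : MDP d S A) (θ : Param d) (x : S × A) : Param d :=
  gradient (fun θ' => Real.log (M.dens θ' x.1 x.2)) θ

/-- Scenario-based gradient `g(s,a|θ) = A^{π_θ}(s,a) ∇ log π_θ(a|s)`, with `A = Q - V`. -/
noncomputable def scenarioGrad (M : MDP d S A) (γ : ℝ) (θ : Param d) (x : S × A) : Param d :=
  (M.Q γ θ x - M.V γ θ x.1) • M.score θ x

/-- The policy gradient `E_{s ∼ dstat θ, a ∼ π_θ(·|s)} [g(s,a|θ)]`. -/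
noncomputable def policyGrad (M : MDP d S A) (γ : ℝ) (dstat : Param d → Measure S)
    (θ : Param d) : Param d :=
  ∫ x, M.scenarioGrad γ θ x ∂(dstat θ ⊗ₘ M.policy θ)

/-- Regularity of rewards and policies: bounded rewards, differentiable policies, Lipschitz and
bounded score, Lipschitz policies in total variation. -/
structure Regular (M : MDP d S A) (Ur UΘ LΘ Uπ : ℝ) : Prop where
  reward_le : ∀ x, |M.reward x| ≤ Ur
  differentiable : ∀ s a, Differentiable ℝ fun θ => M.dens θ s a
  score_lipschitz : ∀ x θ₁ θ₂, ‖M.score θ₁ x - M.score θ₂ x‖ ≤ LΘ * ‖θ₁ - θ₂‖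
  score_le : ∀ x θ, ‖M.score θ x‖ ≤ UΘ
  policy_lipschitz : ∀ s θ₁ θ₂, tvDist (M.policy θ₁ s) (M.policy θ₂ s) ≤ Uπ * ‖θ₁ - θ₂‖

/-- `dstat θ` is a stationary distribution of the state chain under `π_θ`, and the law of `s_t`
given `s₁ = s` is within `κ₀ κᵗ` of it in total variation, for all `t ≥ 1` and all `s`. -/
structure UniformlyErgodic (M : MDP d S A) (dstat : Param d → Measure S) (κ₀ κ : ℝ) : Prop where
  isProbability : ∀ θ, IsProbabilityMeasure (dstat θ)
  invariant : ∀ θ, (M.stateKernel θ).Invariant (dstat θ)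
  mixing : ∀ θ s, ∀ t : ℕ, 1 ≤ t →
    tvDist ((M.stateKernel θ ^ (t - 1)) s) (dstat θ) ≤ κ₀ * κ ^ t

/-- `J` is a bounded objective whose gradient is the policy gradient. -/
structure IsObjective (M : MDP d S A) (γ : ℝ) (dstat : Param d → Measure S) (UJ : ℝ)
    (J : Param d → ℝ) : Prop where
  hasGradientAt : ∀ θ, HasGradientAt J (M.policyGrad γ dstat θ) θ
  abs_le : ∀ θ, |J θ| ≤ UJ

end MDP

/-- The two kinds of estimators: likelihood ratio and clipped likelihood ratio. -/
inductive EstimatorKind where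
  | LR
  | CLR

/-- The weight that a sample with likelihood ratio `f` receives. -/
noncomputable def EstimatorKind.weight (R : EstimatorKind) (Uf f : ℝ) : ℝ :=
  match R with
  | .LR => f
  | .CLR => min f Uf

/-- The random quantities of a run: `θ k` is the policy parameter of iteration `k` and `x k j`,
for `j < n`, is the state-action pair number `j + 1` collected in iteration `k`. Iterations of the
run are numbered `1, 2, …`; indices `≤ 0` serve for parameters and samples which are available
before the run starts. -/
structure Run (d : ℕ) (S A Ω : Type*) where
  θ : ℤ → Ω → Param d
  x : ℤ → ℕ → Ω → S × A

section Estimators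

variable {d : ℕ} {S A Ω : Type*} [MeasurableSpace S] [MeasurableSpace A]

/-- Individual estimator at the target `θ_k` from the `n` samples collected under `θ_i`. -/
noncomputable def indivEstimator (M : MDP d S A) (γ : ℝ) (n : ℕ) (R : EstimatorKind) (Uf : ℝ)
    (X : Run d S A Ω) (i k : ℤ) (ω : Ω) : Param d :=
  (n : ℝ)⁻¹ • ∑ j ∈ Finset.range n,
    R.weight Uf (M.dens (X.θ k ω) (X.x i j ω).1 (X.x i j ω).2 /
        M.dens (X.θ i ω) (X.x i j ω).1 (X.x i j ω).2) •
      M.scenarioGrad γ (X.θ k ω) (X.x i j ω)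

/-- Classical policy gradient estimator of iteration `k`. -/
noncomputable def pgEstimator (M : MDP d S A) (γ : ℝ) (n : ℕ) (X : Run d S A Ω) (k : ℤ)
    (ω : Ω) : Param d :=
  (n : ℝ)⁻¹ • ∑ j ∈ Finset.range n, M.scenarioGrad γ (X.θ k ω) (X.x k j ω)

/-- Indices of the parameters in the replay buffer at iteration `k`: the `B k` most recent ones
among those of the run and the initial stock `F₀`. -/
noncomputable def buffer (B : ℕ → ℕ) (F₀ : Finset ℤ) (k : ℕ) : Finset ℤ :=
  (Finset.Ioc ((k : ℤ) - B k) k).filter fun i => 1 ≤ i ∨ i ∈ F₀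

open Classical in
/-- The reuse set of iteration `k`: the buffered indices whose individual estimator has total
variance at most `c` times that of the classical policy gradient estimator. -/
noncomputable def reuseSet [MeasurableSpace Ω] (M : MDP d S A) (γ : ℝ) (n : ℕ)
    (R : EstimatorKind) (Uf c : ℝ) (B : ℕ → ℕ) (F₀ : Finset ℤ) (μ : Measure Ω)
    (X : Run d S A Ω) (k : ℕ) : Finset ℤ :=
  (buffer B F₀ k).filter fun i =>
    totalVariance (indivEstimator M γ n R Uf X i k) μ ≤
      c * totalVariance (pgEstimator M γ n X k) μ

/-- The average of the individual estimators over the reuse set. -/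
noncomputable def avgEstimator [MeasurableSpace Ω] (M : MDP d S A) (γ : ℝ) (n : ℕ)
    (R : EstimatorKind) (Uf c : ℝ) (B : ℕ → ℕ) (F₀ : Finset ℤ) (μ : Measure Ω)
    (X : Run d S A Ω) (k : ℕ) (ω : Ω) : Param d :=
  ((reuseSet M γ n R Uf c B F₀ μ X k).card : ℝ)⁻¹ •
    ∑ i ∈ reuseSet M γ n R Uf c B F₀ μ X k, indivEstimator M γ n R Uf X i k ω

/-- The iteration to which the time step `l = 0, 1, 2, …` of the run belongs. -/
def stepIter (n l : ℕ) : ℤ := ((l / n : ℕ) : ℤ) + 1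

/-- The state-action pair at the time step `l = 0, 1, 2, …` of the run. -/
def Run.step (X : Run d S A Ω) (n l : ℕ) : Ω → S × A := X.x (stepIter n l) (l % n)

/-- `X` is a run of the policy gradient method with variance reduction experience replay, with
learning rates `η₁ k^{-r}`. The samples form one trajectory of the decision process, in which the
actions of iteration `k` are drawn from `π_{θ_k}`; `ℱ l` is the information available when the
action of time step `l` is about to be drawn. -/
structure IsPGVRER [mΩ : MeasurableSpace Ω] (M : MDP d S A) (γ : ℝ) (n : ℕ) (R : EstimatorKind)
    (Uf c η₁ r : ℝ) (B : ℕ → ℕ) (F₀ : Finset ℤ) (μ : Measure Ω) (ℱ : Filtration ℕ mΩ)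
    (X : Run d S A Ω) : Prop where
  stock_nonpos : ∀ i ∈ F₀, i ≤ 0
  stock_param : ∀ i ∈ F₀, Measurable[ℱ 0] (X.θ i)
  stock_sample : ∀ i ∈ F₀, ∀ j, Measurable[ℱ 0] (X.x i j)
  param_adapted : ∀ k : ℕ, Measurable[ℱ (n * k)] (X.θ (k + 1))
  state_adapted : ∀ l, Measurable[ℱ l] fun ω => (X.step n l ω).1
  action_adapted : ∀ l, Measurable[ℱ (l + 1)] fun ω => (X.step n l ω).2
  /-- Given the past, the action is drawn from the current policy and the next state from the
  transition law. -/
  law : ∀ l, ∀ D : Set (A × S), MeasurableSet D →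
    μ[Set.indicator {ω | ((X.step n l ω).2, (X.step n (l + 1) ω).1) ∈ D}
        (fun _ => (1 : ℝ)) | ℱ l] =ᵐ[μ]
      fun ω => ((M.policy (X.θ (stepIter n l) ω) ⊗ₖ M.trans) (X.step n l ω).1).real D
  update : ∀ k : ℕ, 1 ≤ k → ∀ ω, X.θ (k + 1) ω =
    X.θ k ω + (η₁ * (k : ℝ) ^ (-r)) • avgEstimator M γ n R Uf c B F₀ μ X k ω

/-- The average over the first `K` iterations of the expected squared gradient norm. -/
noncomputable def avgSqGrad [MeasurableSpace Ω] (J : Param d → ℝ) (μ : Measure Ω)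
    (X : Run d S A Ω) (K : ℕ) : ℝ :=
  (1 / (K : ℝ)) * ∑ k ∈ Finset.Icc 1 K, ∫ ω, ‖gradient J (X.θ (k : ℤ) ω)‖ ^ 2 ∂μ

end Estimators

/-- The lag `t*_K = log_κ (K^{-r/n})`. -/
noncomputable def mixingLag (κ r : ℝ) (n K : ℕ) : ℝ :=
  Real.logb κ ((K : ℝ) ^ (-(r / n)))

end VRER

/-! The argument is gradient ascent with a biased direction. Since `∇J` is Lipschitz, one update
raises `J` by at least `η_k ⟪∇J(θ_k), average estimator⟫` minus `O(η_k²)`; the variance of the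
estimators never enters, because they are uniformly bounded. What remains is to bound the inner
product from below, in expectation, by `min 1 Uf * E‖∇J(θ_k)‖²` minus a small bias. The reuse set is
deterministic, being defined through variances, so each reused index can be treated separately
(`IsPGVRER.integral_weighted_pairing_ge`).

For a sample from iteration `i`, look back `m` further iterations to a parameter `θ_{p+1}`.
Parameters move by `O(η)` per iteration and log-densities are Lipschitz, so the weight may be
replaced by `min 1 Uf` and `θ_k` by `θ_{p+1}`, at a cost proportional to the drift
(`weighted_pairing_ge`). The older parameter is known before the samples of iteration `p+1` are
drawn. From then on, the real trajectory is compared with the chain whose policy is frozen at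
`θ_{p+1}`; this costs one policy perturbation per step, and the frozen chain mixes geometrically
(`IsPGVRER.abs_integral_sub_stationary_le`). Under its stationary law the pairing of `∇J` with the
scenario gradient has mean `‖∇J‖²`, by the policy gradient formula.

With `N = B_K + m`, the bias at `k > N` is `O((N + (m+1)²) η_{k-N} + κ^{nm})`
(`IsPGVRER.expected_ascent`). Dividing by `η_k` and summing by parts (`sum_le_of_ascent`) leaves
`O(K^r)` from the bounded objective, a rate sum of order `K^{1-r}`, and a trivial bound for the
first `N` terms. Taking `m = ⌈t*_K⌉` makes the mixing error at most of order `K^{-r}`.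

The Lipschitz bound for `∇J` combines Lipschitz dependence of the scenario gradient on the parameter
with a perturbation bound for stationary laws (`abs_integral_stationary_sub_le`). -/

namespace VRER

/-! ### Markov kernels tested against bounded functions -/

section BoundedFunctions

variable {α β δ : Type*} [MeasurableSpace α] [MeasurableSpace β] [MeasurableSpace δ]

theorem integrable_of_measurable_of_abs_le {μ : Measure α} [IsFiniteMeasure μ] {f : α → ℝ} {b : ℝ}
    (hf : Measurable f) (hb : ∀ x, |f x| ≤ b) : Integrable f μ :=
  Integrable.of_bound hf.aestronglyMeasurable b (.of_forall hb)

theorem abs_integral_le_of_abs_le {μ : Measure α} [IsProbabilityMeasure μ] {f : α → ℝ} {b : ℝ}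
    (hb : ∀ x, |f x| ≤ b) : |∫ x, f x ∂μ| ≤ b := by
  have := norm_integral_le_of_norm_le_const (μ := μ) (f := f) (C := b) (.of_forall hb)
  simpa using this

theorem measurable_integral_kernel (κ : Kernel α β) {f : β → ℝ} (hf : Measurable f) :
    Measurable fun x => ∫ y, f y ∂κ x :=
  (hf.stronglyMeasurable.integral_kernel (κ := κ)).measurable

theorem measurable_integral_kernel_prod (κ : Kernel α β) [IsSFiniteKernel κ] {f : α × β → ℝ}
    (hf : Measurable f) : Measurable fun x => ∫ y, f (x, y) ∂κ x :=
  (hf.stronglyMeasurable.integral_kernel_prod_right' (κ := κ)).measurable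

theorem abs_measureReal_sub_le_tvDist {μ ν : Measure α} [IsProbabilityMeasure μ]
    [IsProbabilityMeasure ν] {D : Set α} (hD : MeasurableSet D) :
    |μ.real D - ν.real D| ≤ tvDist μ ν := by
  refine le_ciSup (f := fun D : {D : Set α // MeasurableSet D} => |μ.real D.1 - ν.real D.1|)
    ⟨1, ?_⟩ ⟨D, hD⟩
  rintro _ ⟨E, rfl⟩
  have h₁ : μ.real E.1 ≤ 1 := measureReal_le_one
  have h₂ : ν.real E.1 ≤ 1 := measureReal_le_one
  have h₃ : 0 ≤ μ.real E.1 := measureReal_nonneg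
  have h₄ : 0 ≤ ν.real E.1 := measureReal_nonneg
  exact abs_le.2 ⟨by linarith, by linarith⟩

/-- Layer-cake estimate: integrals of a function with values in `[-b, b]` against two probability
measures differ by at most `2b` times their total variation distance. -/
theorem abs_integral_sub_le_tvDist {μ ν : Measure α} [IsProbabilityMeasure μ]
    [IsProbabilityMeasure ν] {f : α → ℝ} {b : ℝ} (hf : Measurable f) (hb : ∀ x, |f x| ≤ b) :
    |∫ x, f x ∂μ - ∫ x, f x ∂ν| ≤ 2 * b * tvDist μ ν := by
  have hne : Nonempty α := nonempty_of_isProbabilityMeasure μ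
  have hb₀ : 0 ≤ b := (abs_nonneg _).trans (hb hne.some)
  -- `f + b` takes values in `[0, 2b]`, so the layer-cake integral runs over an interval of length
  -- `2b`, and at each level the two measures differ by at most `tvDist`.
  have key : ∀ ρ : Measure α, IsProbabilityMeasure ρ →
      ∫ x, f x ∂ρ = (∫ t in Set.Ioc 0 (2 * b), ρ.real {x | t ≤ f x + b}) - b := by
    intro ρ hρ
    have hint := integrable_of_measurable_of_abs_le (μ := ρ) hf hb
    have h := (hint.add (integrable_const b)).integral_eq_integral_Ioc_meas_le (M := 2 * b)
      (.of_forall fun x => by have := abs_le.1 (hb x); simp; linarith)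
      (.of_forall fun x => by have := abs_le.1 (hb x); simp; linarith)
    have h' : ∫ x, (f x + b) ∂ρ = ∫ x, f x ∂ρ + b := by
      rw [integral_add hint (integrable_const b)]
      simp
    simp only [Pi.add_apply, h'] at h
    linarith
  have hmono : ∀ ρ : Measure α, IsProbabilityMeasure ρ →
      IntegrableOn (fun t => ρ.real {x | t ≤ f x + b}) (Set.Ioc 0 (2 * b)) := by
    intro ρ hρ
    refine Measure.integrableOn_of_bounded (M := 1)
      (by rw [Real.volume_Ioc]; exact ENNReal.ofReal_ne_top) ?_ ?_
    · refine Antitone.measurable (fun s t hst => measureReal_mono ?_) |>.aestronglyMeasurable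
      exact fun x hx => le_trans hst hx
    · refine .of_forall fun t => ?_
      rw [Real.norm_of_nonneg measureReal_nonneg]
      exact measureReal_le_one
  rw [key μ inferInstance, key ν inferInstance, sub_sub_sub_cancel_right,
    ← integral_sub (hmono μ inferInstance) (hmono ν inferInstance)]
  have hle : ‖∫ t in Set.Ioc 0 (2 * b), (μ.real {x | t ≤ f x + b} - ν.real {x | t ≤ f x + b})‖ ≤
      tvDist μ ν * volume.real (Set.Ioc 0 (2 * b)) :=
    norm_setIntegral_le_of_norm_le_const measure_Ioc_lt_top fun t _ =>
      abs_measureReal_sub_le_tvDist (measurableSet_le measurable_const (hf.add_const b))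
  refine hle.trans (le_of_eq ?_)
  simp [hb₀, mul_comm]

theorem integral_kernel_comp (κ : Kernel α β) (η : Kernel β δ) [IsMarkovKernel κ]
    [IsMarkovKernel η] {f : δ → ℝ} {b : ℝ} (hf : Measurable f) (hb : ∀ x, |f x| ≤ b) (x : α) :
    ∫ z, f z ∂((η ∘ₖ κ) x) = ∫ y, ∫ z, f z ∂η y ∂κ x :=
  Kernel.integral_comp (integrable_of_measurable_of_abs_le hf hb)

theorem integral_of_invariant {μ : Measure α} [IsProbabilityMeasure μ] {κ : Kernel α α}
    [IsMarkovKernel κ] (hμ : κ.Invariant μ) {f : α → ℝ} {b : ℝ} (hf : Measurable f)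
    (hb : ∀ x, |f x| ≤ b) : ∫ x, ∫ y, f y ∂κ x ∂μ = ∫ x, f x ∂μ := by
  have h := integral_kernel_comp (Kernel.const Unit μ) κ hf hb ()
  rw [Kernel.comp_apply, Kernel.const_apply, hμ.def] at h
  exact h.symm

instance isMarkovKernel_pow (κ : Kernel α α) [IsMarkovKernel κ] (t : ℕ) :
    IsMarkovKernel (κ ^ t) := by
  induction t with
  | zero => rw [pow_zero]; exact inferInstanceAs (IsMarkovKernel Kernel.id)
  | succ t ih => rw [Kernel.pow_add, pow_one]; infer_instance

theorem integral_kernel_pow_succ (κ : Kernel α α) [IsMarkovKernel κ] {f : α → ℝ} {b : ℝ}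
    (hf : Measurable f) (hb : ∀ x, |f x| ≤ b) (t : ℕ) (x : α) :
    ∫ z, f z ∂((κ ^ (t + 1)) x) = ∫ y, ∫ z, f z ∂(κ ^ t) y ∂κ x := by
  rw [Kernel.pow_add, pow_one, integral_kernel_comp _ _ hf hb]

theorem integral_kernel_pow_zero (κ : Kernel α α) {f : α → ℝ} (hf : Measurable f) (x : α) :
    ∫ z, f z ∂((κ ^ 0) x) = f x := by
  rw [pow_zero]
  change ∫ z, f z ∂(Kernel.id x) = f x
  rw [Kernel.id_apply, integral_dirac' _ _ hf.stronglyMeasurable]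

/-- The measures `κ x` and `η x` are uniformly close when tested against bounded functions. -/
def KernelDistLE (κ η : Kernel α β) (ε : ℝ) : Prop :=
  ∀ (x : α) (f : β → ℝ) (b : ℝ), Measurable f → (∀ y, |f y| ≤ b) →
    |∫ y, f y ∂κ x - ∫ y, f y ∂η x| ≤ b * ε

theorem KernelDistLE.refl (κ : Kernel α β) : KernelDistLE κ κ 0 := by
  intro x f b _ _; simp

/-- Pass through the hybrid `η₁ ∘ₖ κ₂`. Integration against a Markov kernel preserves the bound `b`,
so errors add without any factor and grow only linearly under powers. -/
theorem KernelDistLE.comp {κ₁ κ₂ : Kernel α β} {η₁ η₂ : Kernel β δ} [IsMarkovKernel κ₁]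
    [IsMarkovKernel κ₂] [IsMarkovKernel η₁] [IsMarkovKernel η₂] {ε ε' : ℝ}
    (hη : KernelDistLE η₁ η₂ ε') (hκ : KernelDistLE κ₁ κ₂ ε) :
    KernelDistLE (η₁ ∘ₖ κ₁) (η₂ ∘ₖ κ₂) (ε + ε') := by
  intro x f b hf hb
  rw [integral_kernel_comp _ _ hf hb, integral_kernel_comp _ _ hf hb]
  have m₁ := measurable_integral_kernel η₁ hf
  have m₂ := measurable_integral_kernel η₂ hf
  have b₁ : ∀ y, |∫ z, f z ∂η₁ y| ≤ b := fun y => abs_integral_le_of_abs_le hb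
  have b₂ : ∀ y, |∫ z, f z ∂η₂ y| ≤ b := fun y => abs_integral_le_of_abs_le hb
  have e₁ := hκ x _ b m₁ b₁
  have e₂ : |∫ y, (∫ z, f z ∂η₁ y - ∫ z, f z ∂η₂ y) ∂κ₂ x| ≤ b * ε' :=
    abs_integral_le_of_abs_le fun y => hη y f b hf hb
  rw [integral_sub (integrable_of_measurable_of_abs_le m₁ b₁)
    (integrable_of_measurable_of_abs_le m₂ b₂)] at e₂
  calc _ ≤ _ := abs_sub_le _ (∫ y, ∫ z, f z ∂η₁ y ∂κ₂ x) _
    _ ≤ b * ε + b * ε' := add_le_add e₁ e₂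
    _ = _ := by ring

theorem KernelDistLE.pow {κ η : Kernel α α} [IsMarkovKernel κ] [IsMarkovKernel η] {ε : ℝ}
    (h : KernelDistLE κ η ε) (t : ℕ) : KernelDistLE (κ ^ t) (η ^ t) (t * ε) := by
  induction t with
  | zero => rw [pow_zero, pow_zero, Nat.cast_zero, zero_mul]; exact KernelDistLE.refl 1
  | succ t ih =>
    rw [Kernel.pow_add, Kernel.pow_add, pow_one, pow_one]
    convert ih.comp h using 1
    push_cast; ring

/-- Perturbation bound for stationary distributions of uniformly ergodic chains. -/
theorem abs_integral_stationary_sub_le {μ₁ μ₂ : Measure α} [IsProbabilityMeasure μ₁]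
    [IsProbabilityMeasure μ₂] {P₁ P₂ : Kernel α α} [IsMarkovKernel P₁] [IsMarkovKernel P₂]
    (h₁ : P₁.Invariant μ₁) {ε : ℝ} (hε : 0 ≤ ε) (hP : KernelDistLE P₁ P₂ ε) {κ₀ κ : ℝ}
    (hκ₀ : 0 ≤ κ₀) (hκ : 0 ≤ κ) (hκ₁ : κ < 1)
    (hmix : ∀ (t : ℕ) (x : α), tvDist ((P₂ ^ t) x) μ₂ ≤ κ₀ * κ ^ (t + 1))
    {f : α → ℝ} {b : ℝ} (hf : Measurable f) (hb : ∀ x, |f x| ≤ b) :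
    |∫ x, f x ∂μ₁ - ∫ x, f x ∂μ₂| ≤ b * (2 * κ₀ * (1 - κ)⁻¹ * ε) := by
  have hne : Nonempty α := nonempty_of_isProbabilityMeasure μ₁
  have hb₀ : 0 ≤ b := (abs_nonneg _).trans (hb hne.some)
  set m : ℝ := ∫ x, f x ∂μ₂ with hm
  -- The centred iterates `P₂ᵗ f - m` decay geometrically by mixing, and `P₂` maps each one to the
  -- next.
  let h : ℕ → α → ℝ := fun t x => ∫ y, f y ∂(P₂ ^ t) x - m
  have hmeas : ∀ t, Measurable (h t) := fun t =>
    (measurable_integral_kernel (P₂ ^ t) hf).sub_const m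
  have hbd : ∀ t x, |h t x| ≤ 2 * b * κ₀ * κ ^ t := by
    intro t x
    refine (abs_integral_sub_le_tvDist hf hb).trans ?_
    calc 2 * b * tvDist ((P₂ ^ t) x) μ₂ ≤ 2 * b * (κ₀ * κ ^ t) := by
          gcongr
          exact (hmix t x).trans (mul_le_mul_of_nonneg_left
            (pow_le_pow_of_le_one hκ hκ₁.le (Nat.le_succ t)) hκ₀)
      _ = _ := by ring
  have hrec : ∀ t x, ∫ y, h t y ∂P₂ x = h (t + 1) x := by
    intro t x
    simp only [h]
    rw [integral_kernel_pow_succ P₂ hf hb, integral_sub _ (integrable_const _)]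
    · simp
    · exact integrable_of_measurable_of_abs_le (measurable_integral_kernel (P₂ ^ t) hf)
        fun x => abs_integral_le_of_abs_le hb
  -- Invariance rewrites the `μ₁`-integral of `h t` as that of `P₁ (h t)`, while `h (t + 1) = P₂ (h
  -- t)`: the increment is one kernel perturbation of a function of size `κᵗ`.
  have hstep : ∀ t, |∫ x, h t x ∂μ₁ - ∫ x, h (t + 1) x ∂μ₁| ≤ 2 * b * κ₀ * κ ^ t * ε := by
    intro t
    rw [← integral_of_invariant h₁ (hmeas t) (hbd t), ← integral_sub]
    · refine abs_integral_le_of_abs_le fun x => ?_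
      rw [← hrec]
      exact hP x _ _ (hmeas t) (hbd t)
    · exact integrable_of_measurable_of_abs_le (measurable_integral_kernel P₁ (hmeas t))
        fun x => abs_integral_le_of_abs_le (hbd t)
    · exact integrable_of_measurable_of_abs_le (hmeas _) (hbd _)
  have htel : ∀ T : ℕ, |∫ x, h 0 x ∂μ₁| ≤
      (∑ t ∈ Finset.range T, 2 * b * κ₀ * κ ^ t * ε) + 2 * b * κ₀ * κ ^ T := by
    intro T
    have e : ∫ x, h 0 x ∂μ₁ = (∑ t ∈ Finset.range T, (∫ x, h t x ∂μ₁ - ∫ x, h (t + 1) x ∂μ₁)) +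
        ∫ x, h T x ∂μ₁ := by
      rw [Finset.sum_range_sub' (fun t => ∫ x, h t x ∂μ₁)]; ring
    rw [e]
    refine (abs_add_le _ _).trans (add_le_add ?_ (abs_integral_le_of_abs_le (hbd T)))
    exact (Finset.abs_sum_le_sum_abs _ _).trans (Finset.sum_le_sum fun t _ => hstep t)
  have hgeom : ∀ T : ℕ, |∫ x, h 0 x ∂μ₁| ≤ b * (2 * κ₀ * (1 - κ)⁻¹ * ε) + 2 * b * κ₀ * κ ^ T := by
    intro T
    refine (htel T).trans ?_
    gcongr
    have : ∑ t ∈ Finset.range T, κ ^ t ≤ (1 - κ)⁻¹ := by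
      rw [← tsum_geometric_of_lt_one hκ hκ₁]
      exact (summable_geometric_of_lt_one hκ hκ₁).sum_le_tsum _ fun t _ => pow_nonneg hκ t
    calc ∑ t ∈ Finset.range T, 2 * b * κ₀ * κ ^ t * ε
        = b * (2 * κ₀ * (∑ t ∈ Finset.range T, κ ^ t) * ε) := by
          simp only [Finset.mul_sum, Finset.sum_mul]
          exact Finset.sum_congr rfl fun t _ => by ring
      _ ≤ _ := by gcongr
  have hlim : Tendsto (fun T : ℕ => b * (2 * κ₀ * (1 - κ)⁻¹ * ε) + 2 * b * κ₀ * κ ^ T) atTop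
      (𝓝 (b * (2 * κ₀ * (1 - κ)⁻¹ * ε) + 2 * b * κ₀ * 0)) :=
    ((tendsto_pow_atTop_nhds_zero_of_lt_one hκ hκ₁).const_mul _).const_add _
  have hfin := ge_of_tendsto' hlim hgeom
  have h0 : ∫ x, h 0 x ∂μ₁ = ∫ x, f x ∂μ₁ - m := by
    simp only [h, integral_kernel_pow_zero P₂ hf]
    rw [integral_sub (integrable_of_measurable_of_abs_le hf hb) (integrable_const _)]
    simp
  rw [h0] at hfin
  simpa using hfin

end BoundedFunctions

/-! ### Discounted sums -/

section Discounting

variable {γ : ℝ}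

/-- The sum of `(t + 1) γᵗ` over all `t`. -/
noncomputable def discountSum (γ : ℝ) : ℝ := ∑' t : ℕ, ((t : ℝ) + 1) * γ ^ t

theorem summable_discountSum (hγ₀ : 0 ≤ γ) (hγ₁ : γ < 1) :
    Summable fun t : ℕ => ((t : ℝ) + 1) * γ ^ t := by
  have hn : ‖γ‖ < 1 := by rwa [Real.norm_of_nonneg hγ₀]
  have h := (summable_pow_mul_geometric_of_norm_lt_one 1 hn).add
    (summable_geometric_of_lt_one hγ₀ hγ₁)
  refine h.congr fun t => ?_
  ring

theorem discountSum_nonneg (hγ₀ : 0 ≤ γ) : 0 ≤ discountSum γ :=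
  tsum_nonneg fun t => by positivity

theorem summable_discounted (hγ₀ : 0 ≤ γ) (hγ₁ : γ < 1) {u : ℕ → ℝ} {b : ℝ}
    (hu : ∀ t, |u t| ≤ b) : Summable fun t => γ ^ t * u t := by
  refine Summable.of_norm_bounded ((summable_geometric_of_lt_one hγ₀ hγ₁).mul_right b) fun t => ?_
  rw [Real.norm_eq_abs, abs_mul, abs_of_nonneg (pow_nonneg hγ₀ t)]
  exact mul_le_mul_of_nonneg_left (hu t) (pow_nonneg hγ₀ t)

theorem abs_tsum_discounted_le (hγ₀ : 0 ≤ γ) (hγ₁ : γ < 1) {u : ℕ → ℝ} {b : ℝ}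
    (hu : ∀ t, |u t| ≤ b) : |∑' t, γ ^ t * u t| ≤ b * (1 - γ)⁻¹ := by
  have h := (hasSum_geometric_of_lt_one hγ₀ hγ₁).mul_left b
  rw [← Real.norm_eq_abs]
  refine tsum_of_norm_bounded h fun t => ?_
  rw [Real.norm_eq_abs, abs_mul, abs_of_nonneg (pow_nonneg hγ₀ t), mul_comm]
  exact mul_le_mul_of_nonneg_right (hu t) (pow_nonneg hγ₀ t)

/-- Perturbing the policy produces an error that grows linearly in time, which is still summable
against `γᵗ`. -/
theorem abs_tsum_discounted_sub_le (hγ₀ : 0 ≤ γ) (hγ₁ : γ < 1) {u v : ℕ → ℝ} {b e : ℝ}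
    (hu : ∀ t, |u t| ≤ b) (hv : ∀ t, |v t| ≤ b) (h : ∀ t, |u t - v t| ≤ (t + 1) * e) :
    |∑' t, γ ^ t * u t - ∑' t, γ ^ t * v t| ≤ discountSum γ * e := by
  rw [← (summable_discounted hγ₀ hγ₁ hu).tsum_sub (summable_discounted hγ₀ hγ₁ hv)]
  have hs := (summable_discountSum hγ₀ hγ₁).hasSum.mul_right e
  rw [← Real.norm_eq_abs]
  refine tsum_of_norm_bounded hs fun t => ?_
  rw [← mul_sub, Real.norm_eq_abs, abs_mul, abs_of_nonneg (pow_nonneg hγ₀ t)]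
  calc γ ^ t * |u t - v t| ≤ γ ^ t * ((t + 1) * e) :=
        mul_le_mul_of_nonneg_left (h t) (pow_nonneg hγ₀ t)
    _ = _ := by ring

end Discounting

/-! ### Measurability of gradients -/

theorem measurable_param_of_inner_single {α : Type*} [MeasurableSpace α] {d : ℕ}
    {f : α → Param d}
    (hf : ∀ i, Measurable fun x => inner ℝ (f x) (EuclideanSpace.single i (1 : ℝ))) :
    Measurable f := by
  have h : Measurable fun x => (fun i => f x i : Fin d → ℝ) := by
    refine measurable_pi_lambda _ fun i => ?_
    simpa [EuclideanSpace.inner_single_right] using hf i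
  exact (WithLp.measurable_toLp 2 (Fin d → ℝ)).comp h

/-- The gradient in a parameter is measurable in the remaining variable. -/
theorem measurable_gradient_of_measurable {α : Type*} [MeasurableSpace α] {d : ℕ}
    {f : α → Param d → ℝ} (θ : Param d) (hf : ∀ θ, Measurable fun x => f x θ)
    (hd : ∀ x, DifferentiableAt ℝ (f x) θ) : Measurable fun x => gradient (f x) θ := by
  refine measurable_param_of_inner_single fun i => ?_
  set e : Param d := EuclideanSpace.single i (1 : ℝ)
  have hc : Tendsto (fun n : ℕ => ‖((n : ℝ))‖) atTop atTop := by
    simpa using tendsto_natCast_atTop_atTop (R := ℝ)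
  -- Each partial derivative is a pointwise limit of the difference quotients with increments `e /
  -- n`.
  refine measurable_of_tendsto_metrizable
    (f := fun (n : ℕ) x => (n : ℝ) • (f x (θ + (n : ℝ)⁻¹ • e) - f x θ)) (fun n => ?_)
    (tendsto_pi_nhds.2 fun x => ?_)
  · exact ((hf _).sub (hf _)).const_smul (n : ℝ)
  · rw [inner_gradient_left]
    exact (hd x).hasFDerivAt.lim e hc

/-! ### Bounds and Lipschitz estimates for values, scores and scenario gradients -/

namespace MDP

variable {d : ℕ} {S : Type u} {A : Type v} [MeasurableSpace S] [MeasurableSpace A]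
  {M : MDP d S A} {Ur UΘ LΘ Uπ κ₀ κ γ UJ : ℝ} {dstat : Param d → Measure S} {J : Param d → ℝ}

instance isMarkovKernel_act (M : MDP d S A) (θ : Param d) : IsMarkovKernel (M.act θ) := by
  unfold act; infer_instance

instance isMarkovKernel_stateKernel (M : MDP d S A) (θ : Param d) :
    IsMarkovKernel (M.stateKernel θ) := by
  unfold stateKernel; infer_instance

instance isMarkovKernel_pairKernel (M : MDP d S A) (θ : Param d) :
    IsMarkovKernel (M.pairKernel θ) := by
  unfold pairKernel; infer_instance

theorem integral_act (M : MDP d S A) (θ : Param d) (s : S) {f : S × A → ℝ} (hf : Measurable f) :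
    ∫ x, f x ∂(M.act θ s) = ∫ a, f (s, a) ∂(M.policy θ s) := by
  rw [act, Kernel.prod_apply, Kernel.id_apply, Measure.dirac_prod,
    integral_map measurable_prodMk_left.aemeasurable hf.aestronglyMeasurable]

theorem integral_stateKernel (M : MDP d S A) (θ : Param d) (s : S) {f : S → ℝ} {b : ℝ}
    (hf : Measurable f) (hb : ∀ s, |f s| ≤ b) :
    ∫ s', f s' ∂(M.stateKernel θ s) = ∫ a, ∫ s', f s' ∂(M.trans (s, a)) ∂(M.policy θ s) := by
  rw [stateKernel, integral_kernel_comp _ _ hf hb,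
    integral_act M θ s (measurable_integral_kernel M.trans hf)]

section Regular

theorem Regular.kernelDistLE_policy (h : M.Regular Ur UΘ LΘ Uπ) (θ₁ θ₂ : Param d) :
    KernelDistLE (M.policy θ₁) (M.policy θ₂) (2 * Uπ * ‖θ₁ - θ₂‖) := by
  intro s f b hf hb
  have hb₀ : 0 ≤ b := by
    have := nonempty_of_isProbabilityMeasure (M.policy θ₁ s)
    exact (abs_nonneg _).trans (hb this.some)
  calc _ ≤ _ := abs_integral_sub_le_tvDist hf hb
    _ ≤ 2 * b * (Uπ * ‖θ₁ - θ₂‖) := by gcongr; exact h.policy_lipschitz s θ₁ θ₂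
    _ = _ := by ring

theorem Regular.kernelDistLE_act (h : M.Regular Ur UΘ LΘ Uπ) (θ₁ θ₂ : Param d) :
    KernelDistLE (M.act θ₁) (M.act θ₂) (2 * Uπ * ‖θ₁ - θ₂‖) := by
  intro s f b hf hb
  rw [integral_act _ _ _ hf, integral_act _ _ _ hf]
  exact h.kernelDistLE_policy θ₁ θ₂ s _ b (hf.comp measurable_prodMk_left) fun a => hb _

/-- The transition law is common to both policies and contributes no error, so only the action draw
counts. -/
theorem Regular.kernelDistLE_stateKernel (h : M.Regular Ur UΘ LΘ Uπ) (θ₁ θ₂ : Param d) :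
    KernelDistLE (M.stateKernel θ₁) (M.stateKernel θ₂) (2 * Uπ * ‖θ₁ - θ₂‖) := by
  have := (KernelDistLE.refl M.trans).comp (h.kernelDistLE_act θ₁ θ₂)
  rwa [add_zero] at this

theorem Regular.kernelDistLE_pairKernel (h : M.Regular Ur UΘ LΘ Uπ) (θ₁ θ₂ : Param d) :
    KernelDistLE (M.pairKernel θ₁) (M.pairKernel θ₂) (2 * Uπ * ‖θ₁ - θ₂‖) := by
  have := (h.kernelDistLE_act θ₁ θ₂).comp (KernelDistLE.refl M.trans)
  rwa [zero_add] at this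

theorem Regular.abs_Q_le (h : M.Regular Ur UΘ LΘ Uπ) (hγ₀ : 0 ≤ γ) (hγ₁ : γ < 1)
    (θ : Param d) (x : S × A) : |M.Q γ θ x| ≤ Ur * (1 - γ)⁻¹ :=
  abs_tsum_discounted_le hγ₀ hγ₁ fun _ => abs_integral_le_of_abs_le h.reward_le

theorem Regular.abs_V_le (h : M.Regular Ur UΘ LΘ Uπ) (hγ₀ : 0 ≤ γ) (hγ₁ : γ < 1)
    (θ : Param d) (s : S) : |M.V γ θ s| ≤ Ur * (1 - γ)⁻¹ :=
  abs_tsum_discounted_le hγ₀ hγ₁ fun _ => abs_integral_le_of_abs_le h.reward_le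

/-- By time `t` the policy has been used `t` times here, and `t + 1` times for `V`; the larger count
serves for both. -/
theorem Regular.abs_Q_sub_le (h : M.Regular Ur UΘ LΘ Uπ) (hγ₀ : 0 ≤ γ) (hγ₁ : γ < 1)
    (hUr : 0 ≤ Ur) (hUπ : 0 ≤ Uπ) (θ₁ θ₂ : Param d) (x : S × A) :
    |M.Q γ θ₁ x - M.Q γ θ₂ x| ≤ discountSum γ * (Ur * (2 * Uπ * ‖θ₁ - θ₂‖)) := by
  refine abs_tsum_discounted_sub_le hγ₀ hγ₁ (b := Ur)
    (fun _ => abs_integral_le_of_abs_le h.reward_le)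
    (fun _ => abs_integral_le_of_abs_le h.reward_le) fun t => ?_
  refine ((h.kernelDistLE_pairKernel θ₁ θ₂).pow t x _ Ur M.measurable_reward h.reward_le).trans ?_
  have : 0 ≤ Ur * (2 * Uπ * ‖θ₁ - θ₂‖) := by positivity
  linarith

theorem Regular.abs_V_sub_le (h : M.Regular Ur UΘ LΘ Uπ) (hγ₀ : 0 ≤ γ) (hγ₁ : γ < 1)
    (θ₁ θ₂ : Param d) (s : S) :
    |M.V γ θ₁ s - M.V γ θ₂ s| ≤ discountSum γ * (Ur * (2 * Uπ * ‖θ₁ - θ₂‖)) := by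
  refine abs_tsum_discounted_sub_le hγ₀ hγ₁ (b := Ur)
    (fun _ => abs_integral_le_of_abs_le h.reward_le)
    (fun _ => abs_integral_le_of_abs_le h.reward_le) fun t => ?_
  refine (((h.kernelDistLE_pairKernel θ₁ θ₂).pow t).comp (h.kernelDistLE_act θ₁ θ₂) s _ Ur
    M.measurable_reward h.reward_le).trans (le_of_eq ?_)
  ring

theorem measurable_Q (M : MDP d S A) (γ : ℝ) (θ : Param d) : Measurable (M.Q γ θ) :=
  Measurable.tsum fun t =>
    (measurable_integral_kernel (M.pairKernel θ ^ t) M.measurable_reward).const_mul _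

theorem measurable_V (M : MDP d S A) (γ : ℝ) (θ : Param d) : Measurable (M.V γ θ) :=
  Measurable.tsum fun t =>
    (measurable_integral_kernel ((M.pairKernel θ ^ t) ∘ₖ M.act θ) M.measurable_reward).const_mul _

theorem Regular.differentiableAt_log_dens (h : M.Regular Ur UΘ LΘ Uπ) (x : S × A) (θ : Param d) :
    DifferentiableAt ℝ (fun θ' => Real.log (M.dens θ' x.1 x.2)) θ :=
  (h.differentiable x.1 x.2 θ).log (M.dens_pos θ x.1 x.2).ne'

theorem Regular.measurable_score (h : M.Regular Ur UΘ LΘ Uπ) (θ : Param d) :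
    Measurable (M.score θ) := by
  refine measurable_gradient_of_measurable (f := fun x θ' => Real.log (M.dens θ' x.1 x.2)) θ
    (fun θ' => Real.measurable_log.comp ?_) fun x => h.differentiableAt_log_dens x θ
  exact M.measurable_dens.comp (measurable_const.prodMk measurable_id)

/-- Mean value inequality with the score bound. It keeps likelihood ratios of nearby parameters
close to one, uniformly in the sample. -/
theorem Regular.abs_log_dens_sub_le (h : M.Regular Ur UΘ LΘ Uπ) (θ₁ θ₂ : Param d) (x : S × A) :
    |Real.log (M.dens θ₁ x.1 x.2) - Real.log (M.dens θ₂ x.1 x.2)| ≤ UΘ * ‖θ₁ - θ₂‖ := by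
  refine convex_univ.norm_image_sub_le_of_norm_fderiv_le (𝕜 := ℝ)
    (f := fun θ' => Real.log (M.dens θ' x.1 x.2))
    (fun θ _ => h.differentiableAt_log_dens x θ) (fun θ _ => ?_) (Set.mem_univ _) (Set.mem_univ _)
  rw [← toDual_gradient, LinearIsometryEquiv.norm_map]
  exact h.score_le x θ

/-- Uniform bound for the scenario-based gradients. -/
noncomputable def gradBound (γ Ur UΘ : ℝ) : ℝ := 2 * (Ur * (1 - γ)⁻¹) * UΘ

/-- Lipschitz constant of the scenario-based gradients. -/
noncomputable def gradLip (γ Ur UΘ LΘ Uπ : ℝ) : ℝ :=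
  2 * (discountSum γ * (Ur * (2 * Uπ))) * UΘ + 2 * (Ur * (1 - γ)⁻¹) * LΘ

theorem Regular.norm_scenarioGrad_le (h : M.Regular Ur UΘ LΘ Uπ) (hγ₀ : 0 ≤ γ) (hγ₁ : γ < 1)
    (θ : Param d) (x : S × A) : ‖M.scenarioGrad γ θ x‖ ≤ gradBound γ Ur UΘ := by
  rw [scenarioGrad, norm_smul, Real.norm_eq_abs]
  have hQ := h.abs_Q_le hγ₀ hγ₁ θ x
  have hV := h.abs_V_le hγ₀ hγ₁ θ x.1
  have hA : |M.Q γ θ x - M.V γ θ x.1| ≤ 2 * (Ur * (1 - γ)⁻¹) :=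
    (abs_sub _ _).trans (by linarith)
  exact mul_le_mul hA (h.score_le x θ) (norm_nonneg _) ((abs_nonneg _).trans hA)

theorem Regular.norm_scenarioGrad_sub_le (h : M.Regular Ur UΘ LΘ Uπ) (hγ₀ : 0 ≤ γ) (hγ₁ : γ < 1)
    (hUr : 0 ≤ Ur) (hUπ : 0 ≤ Uπ) (θ₁ θ₂ : Param d) (x : S × A) :
    ‖M.scenarioGrad γ θ₁ x - M.scenarioGrad γ θ₂ x‖ ≤
      gradLip γ Ur UΘ LΘ Uπ * ‖θ₁ - θ₂‖ := by
  set a₁ := M.Q γ θ₁ x - M.V γ θ₁ x.1 with ha₁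
  set a₂ := M.Q γ θ₂ x - M.V γ θ₂ x.1 with ha₂
  have e : M.scenarioGrad γ θ₁ x - M.scenarioGrad γ θ₂ x =
      (a₁ - a₂) • M.score θ₁ x + a₂ • (M.score θ₁ x - M.score θ₂ x) := by
    simp only [scenarioGrad, ← ha₁, ← ha₂]
    module
  have hQ := h.abs_Q_sub_le hγ₀ hγ₁ hUr hUπ θ₁ θ₂ x
  have hV := h.abs_V_sub_le hγ₀ hγ₁ θ₁ θ₂ x.1
  have hA : |a₁ - a₂| ≤ 2 * (discountSum γ * (Ur * (2 * Uπ * ‖θ₁ - θ₂‖))) := by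
    have : a₁ - a₂ = (M.Q γ θ₁ x - M.Q γ θ₂ x) - (M.V γ θ₁ x.1 - M.V γ θ₂ x.1) := by
      rw [ha₁, ha₂]; ring
    rw [this]
    exact (abs_sub _ _).trans (by linarith)
  have hA₂ : |a₂| ≤ 2 * (Ur * (1 - γ)⁻¹) := by
    have h₁ := h.abs_Q_le hγ₀ hγ₁ θ₂ x
    have h₂ := h.abs_V_le hγ₀ hγ₁ θ₂ x.1
    exact (abs_sub _ _).trans (by linarith)
  rw [e]
  refine (norm_add_le _ _).trans ?_
  rw [norm_smul, norm_smul, Real.norm_eq_abs, Real.norm_eq_abs]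
  have i₁ := mul_le_mul hA (h.score_le x θ₁) (norm_nonneg _) ((abs_nonneg _).trans hA)
  have i₂ := mul_le_mul hA₂ (h.score_lipschitz x θ₁ θ₂) (norm_nonneg _) ((abs_nonneg _).trans hA₂)
  calc _ ≤ _ := add_le_add i₁ i₂
    _ = _ := by rw [gradLip]; ring

theorem Regular.measurable_scenarioGrad (h : M.Regular Ur UΘ LΘ Uπ) (θ : Param d) :
    Measurable (M.scenarioGrad γ θ) :=
  ((M.measurable_Q γ θ).sub ((M.measurable_V γ θ).comp measurable_fst)).smul (h.measurable_score θ)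

/-- The scenario-based gradient is jointly measurable in the parameter and the pair. -/
theorem Regular.measurable_uncurry_scenarioGrad (h : M.Regular Ur UΘ LΘ Uπ) (hγ₀ : 0 ≤ γ)
    (hγ₁ : γ < 1) (hUr : 0 ≤ Ur) (hUπ : 0 ≤ Uπ) :
    Measurable fun z : Param d × (S × A) => M.scenarioGrad γ z.1 z.2 := by
  -- Carathéodory function: Lipschitz in the parameter for each pair, measurable in the pair for
  -- each parameter.
  refine measurable_uncurry_of_continuous_of_measurable (u := fun θ x => M.scenarioGrad γ θ x)
    (fun x => ?_) fun θ => h.measurable_scenarioGrad θ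
  exact (LipschitzWith.of_dist_le' (K := gradLip γ Ur UΘ LΘ Uπ) fun θ₁ θ₂ => by
    rw [dist_eq_norm, dist_eq_norm]
    exact h.norm_scenarioGrad_sub_le hγ₀ hγ₁ hUr hUπ θ₁ θ₂ x).continuous

end Regular

/-! ### Stationary laws and the Lipschitz constant of the policy gradient -/

section Stationary

theorem UniformlyErgodic.tvDist_pow_le (h : M.UniformlyErgodic dstat κ₀ κ) (θ : Param d) (t : ℕ)
    (s : S) : tvDist ((M.stateKernel θ ^ t) s) (dstat θ) ≤ κ₀ * κ ^ (t + 1) :=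
  h.mixing θ s (t + 1) (Nat.le_add_left 1 t)

theorem integral_occupancy (θ : Param d) [IsProbabilityMeasure (dstat θ)] {f : S × A → ℝ} {b : ℝ}
    (hf : Measurable f) (hb : ∀ x, |f x| ≤ b) :
    ∫ x, f x ∂(dstat θ ⊗ₘ M.policy θ) = ∫ s, ∫ a, f (s, a) ∂(M.policy θ s) ∂(dstat θ) :=
  Measure.integral_compProd (integrable_of_measurable_of_abs_le hf hb)

/-- Change the action law first, under `dstat θ₁`, and then the stationary law of the state. The
summand `1` in the constant belongs to the first change, the mixing constant to the second. -/
theorem abs_integral_occupancy_sub_le (hreg : M.Regular Ur UΘ LΘ Uπ)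
    (herg : M.UniformlyErgodic dstat κ₀ κ) (hUπ : 0 ≤ Uπ) (hκ₀ : 0 ≤ κ₀) (hκ : 0 ≤ κ) (hκ₁ : κ < 1)
    (θ₁ θ₂ : Param d) {f : S × A → ℝ} {b : ℝ} (hf : Measurable f) (hb : ∀ x, |f x| ≤ b) :
    |∫ x, f x ∂(dstat θ₁ ⊗ₘ M.policy θ₁) - ∫ x, f x ∂(dstat θ₂ ⊗ₘ M.policy θ₂)| ≤
      b * ((2 * κ₀ * (1 - κ)⁻¹ + 1) * (2 * Uπ)) * ‖θ₁ - θ₂‖ := by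
  have := herg.isProbability
  rw [integral_occupancy θ₁ hf hb, integral_occupancy θ₂ hf hb]
  have hm : ∀ θ, Measurable fun s => ∫ a, f (s, a) ∂(M.policy θ s) := fun θ =>
    measurable_integral_kernel_prod (M.policy θ) hf
  have hbd : ∀ θ s, |∫ a, f (s, a) ∂(M.policy θ s)| ≤ b := fun θ s =>
    abs_integral_le_of_abs_le fun a => hb _
  have e₁ : |∫ s, (∫ a, f (s, a) ∂(M.policy θ₁ s) - ∫ a, f (s, a) ∂(M.policy θ₂ s)) ∂(dstat θ₁)|
      ≤ b * (2 * Uπ * ‖θ₁ - θ₂‖) :=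
    abs_integral_le_of_abs_le fun s => hreg.kernelDistLE_policy θ₁ θ₂ s _ b
      (hf.comp measurable_prodMk_left) fun a => hb _
  rw [integral_sub (integrable_of_measurable_of_abs_le (hm θ₁) (hbd θ₁))
    (integrable_of_measurable_of_abs_le (hm θ₂) (hbd θ₂))] at e₁
  have e₂ := abs_integral_stationary_sub_le (herg.invariant θ₁) (by positivity)
    (hreg.kernelDistLE_stateKernel θ₁ θ₂) hκ₀ hκ hκ₁ (herg.tvDist_pow_le θ₂) (hm θ₂) (hbd θ₂)
  calc _ ≤ _ := abs_sub_le _ (∫ s, ∫ a, f (s, a) ∂(M.policy θ₂ s) ∂(dstat θ₁)) _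
    _ ≤ _ := add_le_add e₁ e₂
    _ = _ := by ring

theorem inner_policyGrad (hreg : M.Regular Ur UΘ LΘ Uπ) (herg : M.UniformlyErgodic dstat κ₀ κ)
    (hγ₀ : 0 ≤ γ) (hγ₁ : γ < 1) (θ v : Param d) :
    inner ℝ v (M.policyGrad γ dstat θ) =
      ∫ x, inner ℝ v (M.scenarioGrad γ θ x) ∂(dstat θ ⊗ₘ M.policy θ) := by
  have := herg.isProbability
  rw [policyGrad, integral_inner]
  exact Integrable.of_bound (hreg.measurable_scenarioGrad θ).aestronglyMeasurable _
    (.of_forall (hreg.norm_scenarioGrad_le hγ₀ hγ₁ θ))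

/-- Lipschitz constant of the policy gradient. -/
noncomputable def policyGradLip (γ Ur UΘ LΘ Uπ κ₀ κ : ℝ) : ℝ :=
  gradLip γ Ur UΘ LΘ Uπ + gradBound γ Ur UΘ * ((2 * κ₀ * (1 - κ)⁻¹ + 1) * (2 * Uπ))

/-- Testing against the difference `v` itself reduces the claim to real integrands: one obtains a
bound for `‖v‖²` with a factor `‖v‖`, which is then cancelled. -/
theorem norm_policyGrad_sub_le (hreg : M.Regular Ur UΘ LΘ Uπ)
    (herg : M.UniformlyErgodic dstat κ₀ κ) (hγ₀ : 0 ≤ γ) (hγ₁ : γ < 1) (hUr : 0 ≤ Ur)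
    (hUπ : 0 ≤ Uπ) (hκ₀ : 0 ≤ κ₀) (hκ : 0 ≤ κ) (hκ₁ : κ < 1) (θ₁ θ₂ : Param d) :
    ‖M.policyGrad γ dstat θ₁ - M.policyGrad γ dstat θ₂‖ ≤
      policyGradLip γ Ur UΘ LΘ Uπ κ₀ κ * ‖θ₁ - θ₂‖ := by
  have := herg.isProbability
  set v := M.policyGrad γ dstat θ₁ - M.policyGrad γ dstat θ₂ with hv
  have hm : ∀ θ, Measurable fun x => inner ℝ v (M.scenarioGrad γ θ x) := fun θ =>
    measurable_const.inner (hreg.measurable_scenarioGrad θ)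
  have hbd : ∀ θ x, |inner ℝ v (M.scenarioGrad γ θ x)| ≤ ‖v‖ * gradBound γ Ur UΘ := fun θ x =>
    (abs_real_inner_le_norm _ _).trans
      (mul_le_mul_of_nonneg_left (hreg.norm_scenarioGrad_le hγ₀ hγ₁ θ x) (norm_nonneg v))
  have e₁ : |∫ x, (inner ℝ v (M.scenarioGrad γ θ₁ x) - inner ℝ v (M.scenarioGrad γ θ₂ x))
      ∂(dstat θ₁ ⊗ₘ M.policy θ₁)| ≤ ‖v‖ * (gradLip γ Ur UΘ LΘ Uπ * ‖θ₁ - θ₂‖) := by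
    refine abs_integral_le_of_abs_le fun x => ?_
    rw [← inner_sub_right]
    exact (abs_real_inner_le_norm _ _).trans (mul_le_mul_of_nonneg_left
      (hreg.norm_scenarioGrad_sub_le hγ₀ hγ₁ hUr hUπ θ₁ θ₂ x) (norm_nonneg v))
  rw [integral_sub (integrable_of_measurable_of_abs_le (hm θ₁) (hbd θ₁))
    (integrable_of_measurable_of_abs_le (hm θ₂) (hbd θ₂))] at e₁
  have e₂ := abs_integral_occupancy_sub_le hreg herg hUπ hκ₀ hκ hκ₁ θ₁ θ₂ (hm θ₂) (hbd θ₂)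
  have key : ‖v‖ * ‖v‖ ≤ ‖v‖ * (policyGradLip γ Ur UΘ LΘ Uπ κ₀ κ * ‖θ₁ - θ₂‖) := by
    calc ‖v‖ * ‖v‖ = inner ℝ v (M.policyGrad γ dstat θ₁) - inner ℝ v (M.policyGrad γ dstat θ₂) := by
          rw [← inner_sub_right, ← hv, real_inner_self_eq_norm_mul_norm]
      _ ≤ ‖v‖ * (gradLip γ Ur UΘ LΘ Uπ * ‖θ₁ - θ₂‖) + ‖v‖ * gradBound γ Ur UΘ *
          ((2 * κ₀ * (1 - κ)⁻¹ + 1) * (2 * Uπ)) * ‖θ₁ - θ₂‖ := by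
          rw [inner_policyGrad hreg herg hγ₀ hγ₁, inner_policyGrad hreg herg hγ₀ hγ₁]
          exact (le_abs_self _).trans ((abs_sub_le _ _ _).trans (add_le_add e₁ e₂))
      _ = _ := by rw [policyGradLip]; ring
  rcases (norm_nonneg v).eq_or_lt with h0 | hpos
  · rw [← h0]
    -- No signs of `UΘ` and `LΘ` are at hand, so nonnegativity is read off from the norm bounds at
    -- some state-action pair.
    have h₁ : 0 ≤ gradBound γ Ur UΘ := by
      obtain ⟨x⟩ := nonempty_of_isProbabilityMeasure (dstat θ₁ ⊗ₘ M.policy θ₁)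
      exact (norm_nonneg _).trans (hreg.norm_scenarioGrad_le hγ₀ hγ₁ θ₁ x)
    have h₂ : 0 ≤ gradLip γ Ur UΘ LΘ Uπ * ‖θ₁ - θ₂‖ := by
      obtain ⟨x⟩ := nonempty_of_isProbabilityMeasure (dstat θ₁ ⊗ₘ M.policy θ₁)
      exact (norm_nonneg _).trans (hreg.norm_scenarioGrad_sub_le hγ₀ hγ₁ hUr hUπ θ₁ θ₂ x)
    have h₃ : 0 ≤ (1 - κ)⁻¹ := inv_nonneg.2 (sub_nonneg.2 hκ₁.le)
    rw [policyGradLip, add_mul]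
    positivity
  · exact le_of_mul_le_mul_left key hpos

theorem norm_policyGrad_le (hreg : M.Regular Ur UΘ LΘ Uπ) (herg : M.UniformlyErgodic dstat κ₀ κ)
    (hγ₀ : 0 ≤ γ) (hγ₁ : γ < 1) (θ : Param d) :
    ‖M.policyGrad γ dstat θ‖ ≤ gradBound γ Ur UΘ := by
  have := herg.isProbability
  have := norm_integral_le_of_norm_le_const (μ := dstat θ ⊗ₘ M.policy θ)
    (.of_forall (hreg.norm_scenarioGrad_le hγ₀ hγ₁ θ))
  simpa [policyGrad] using this

theorem IsObjective.gradient_eq (h : M.IsObjective γ dstat UJ J) (θ : Param d) :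
    gradient J θ = M.policyGrad γ dstat θ :=
  (h.hasGradientAt θ).gradient

end Stationary

end MDP

/-! ### From conditional laws to kernels, and the chain with a frozen policy -/

/-- If the conditional law of `Y` given `m` is `κ (Z ·)` with `Z` measurable with respect to `m`,
then the joint law of `(Z, Y)` is the composition-product of the law of `Z` with `κ`. -/
theorem map_prodMk_eq_compProd {Ω β δ : Type*} {m mΩ : MeasurableSpace Ω} [MeasurableSpace β]
    [MeasurableSpace δ] (hm : m ≤ mΩ) {μ : Measure Ω} [IsProbabilityMeasure μ] {Z : Ω → β}
    (hZ : Measurable[m] Z) {Y : Ω → δ} (hY : Measurable Y) (κ : Kernel β δ) [IsMarkovKernel κ]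
    (hlaw : ∀ D : Set δ, MeasurableSet D →
      μ[Set.indicator {ω | Y ω ∈ D} (fun _ => (1 : ℝ)) | m] =ᵐ[μ] fun ω => (κ (Z ω)).real D) :
    μ.map (fun ω => (Z ω, Y ω)) = μ.map Z ⊗ₘ κ := by
  have hZ' : Measurable Z := hZ.mono hm le_rfl
  have hprob : IsProbabilityMeasure (μ.map Z) := Measure.isProbabilityMeasure_map hZ'.aemeasurable
  have hprob' : IsProbabilityMeasure (μ.map fun ω => (Z ω, Y ω)) :=
    Measure.isProbabilityMeasure_map (hZ'.prodMk hY).aemeasurable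
  refine Measure.ext_prod fun {s t} hs ht => ?_
  rw [Measure.map_apply (hZ'.prodMk hY) (hs.prod ht), Measure.compProd_apply_prod hs ht,
    setLIntegral_map hs (κ.measurable_coe ht) hZ']
  -- `Z ⁻¹' s` belongs to `m`, so the defining property of conditional expectation applies on it;
  -- agreement on rectangles suffices.
  have e₁ : ∫ ω in Z ⁻¹' s, (κ (Z ω)).real t ∂μ = μ.real (Z ⁻¹' s ∩ Y ⁻¹' t) := by
    have hint : Integrable (Set.indicator {ω | Y ω ∈ t} (fun _ => (1 : ℝ))) μ :=
      (integrable_const 1).indicator (hY ht)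
    rw [← setIntegral_congr_ae (hZ' hs) ((hlaw t ht).mono fun ω h _ => h),
      setIntegral_condExp hm hint (hZ hs), setIntegral_indicator (s := Z ⁻¹' s) (t := {ω | Y ω ∈ t}) (hY ht)]
    simp
    rfl
  have e₂ : ∫⁻ ω in Z ⁻¹' s, κ (Z ω) t ∂μ = ENNReal.ofReal (∫ ω in Z ⁻¹' s, (κ (Z ω)).real t ∂μ) := by
    rw [ofReal_integral_eq_lintegral_ofReal]
    · refine lintegral_congr fun ω => ?_
      rw [ofReal_measureReal]
    · refine integrable_of_measurable_of_abs_le (b := 1) ?_ fun ω => ?_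
      · exact ((κ.measurable_coe ht).comp hZ').ennreal_toReal
      · rw [abs_of_nonneg measureReal_nonneg]
        exact measureReal_le_one
    · exact .of_forall fun ω => measureReal_nonneg
  rw [e₂, e₁, ofReal_measureReal]
  rfl

namespace MDP

variable {d : ℕ} {S : Type u} {A : Type v} [MeasurableSpace S] [MeasurableSpace A]
  {M : MDP d S A} {Ur UΘ LΘ Uπ κ₀ κ γ UJ : ℝ} {dstat : Param d → Measure S} {J : Param d → ℝ}

/-- The policy as a kernel in the parameter and the state together. -/
noncomputable def jointPolicy (M : MDP d S A) : Kernel (Param d × S) A :=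
  Kernel.withDensity (Kernel.const (Param d × S) M.actionRef)
    fun p a => ((M.dens p.1 p.2 a).toNNReal : ℝ≥0∞)

theorem jointPolicy_apply (M : MDP d S A) (p : Param d × S) :
    M.jointPolicy p = M.policy p.1 p.2 := by
  rw [policy_apply, jointPolicy, Kernel.withDensity_apply]
  · rfl
  · have h : Measurable fun z : (Param d × S) × A => M.dens z.1.1 z.1.2 z.2 :=
      M.measurable_dens.comp (by fun_prop : Measurable fun z : (Param d × S) × A =>
        (z.1.1, z.1.2, z.2))
    exact h.real_toNNReal.coe_nnreal_ennreal

instance isMarkovKernel_jointPolicy (M : MDP d S A) : IsMarkovKernel M.jointPolicy :=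
  ⟨fun p => by rw [jointPolicy_apply]; infer_instance⟩

/-- The law of the action and the next state, given the parameter and the state. -/
noncomputable def jointStep (M : MDP d S A) : Kernel (Param d × S) (A × S) :=
  M.jointPolicy ⊗ₖ M.trans.comap (fun z : (Param d × S) × A => (z.1.2, z.2)) (by fun_prop)

instance isMarkovKernel_jointStep (M : MDP d S A) : IsMarkovKernel M.jointStep := by
  unfold jointStep; infer_instance

/-- Connects the jointly measurable kernel, which a random parameter requires, with the expression
in the field `law` of `IsPGVRER`. -/
theorem jointStep_apply (M : MDP d S A) (p : Param d × S) :
    M.jointStep p = (M.policy p.1 ⊗ₖ M.trans) p.2 := by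
  ext D hD
  rw [jointStep, Kernel.compProd_apply hD, Kernel.compProd_apply hD, jointPolicy_apply]
  simp only [Kernel.comap_apply]

theorem integral_jointStep (M : MDP d S A) (p : Param d × S) {f : A × S → ℝ} {b : ℝ}
    (hf : Measurable f) (hb : ∀ y, |f y| ≤ b) :
    ∫ y, f y ∂(M.jointStep p) =
      ∫ a, ∫ s', f (a, s') ∂(M.trans (p.2, a)) ∂(M.policy p.1 p.2) := by
  rw [jointStep_apply, integral_compProd (integrable_of_measurable_of_abs_le hf hb)]

theorem integral_jointStep_snd (M : MDP d S A) (p : Param d × S) {f : S → ℝ} {b : ℝ}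
    (hf : Measurable f) (hb : ∀ y, |f y| ≤ b) :
    ∫ y, f y.2 ∂(M.jointStep p) = ∫ s', f s' ∂(M.stateKernel p.1 p.2) := by
  rw [integral_jointStep M p (f := fun y => f y.2) (hf.comp measurable_snd) fun y => hb y.2,
    integral_stateKernel M p.1 p.2 hf hb]

theorem integral_jointStep_fst (M : MDP d S A) (p : Param d × S) {f : A → ℝ} {b : ℝ}
    (hf : Measurable f) (hb : ∀ y, |f y| ≤ b) :
    ∫ y, f y.1 ∂(M.jointStep p) = ∫ a, f a ∂(M.policy p.1 p.2) := by
  rw [integral_jointStep M p (f := fun y => f y.1) (hf.comp measurable_fst) fun y => hb y.1]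
  simp

/-- The expectation of `F (θ, ·)` at the state-action pair which the chain under the fixed policy
`π_θ` reaches `t` steps after the state `s`, as a function of `(θ, s)`. -/
noncomputable def rollout (M : MDP d S A) (F : Param d × (S × A) → ℝ) : ℕ → Param d × S → ℝ
  | 0, p => ∫ a, F (p.1, (p.2, a)) ∂(M.jointPolicy p)
  | t + 1, p => ∫ y, rollout M F t (p.1, y.2) ∂(M.jointStep p)

variable {F : Param d × (S × A) → ℝ} {b : ℝ}

theorem measurable_rollout (hF : Measurable F) (t : ℕ) : Measurable (M.rollout F t) := by
  induction t with
  | zero =>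
    refine measurable_integral_kernel_prod M.jointPolicy
      (f := fun z : (Param d × S) × A => F (z.1.1, (z.1.2, z.2))) ?_
    exact hF.comp (by fun_prop)
  | succ t ih =>
    refine measurable_integral_kernel_prod M.jointStep
      (f := fun z : (Param d × S) × (A × S) => M.rollout F t (z.1.1, z.2.2)) ?_
    exact ih.comp (by fun_prop)

theorem abs_rollout_le (hb : ∀ z, |F z| ≤ b) (t : ℕ) (p : Param d × S) :
    |M.rollout F t p| ≤ b := by
  induction t generalizing p with
  | zero => exact abs_integral_le_of_abs_le fun a => hb _
  | succ t ih => exact abs_integral_le_of_abs_le fun y => ih _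

theorem measurable_rollout_right (hF : Measurable F) (t : ℕ) (θ : Param d) :
    Measurable fun s => M.rollout F t (θ, s) :=
  (measurable_rollout hF t).comp measurable_prodMk_left

/-- The mixing assumption speaks of powers of the state kernel; this form makes it applicable to
rollouts. -/
theorem rollout_eq_integral_pow (hF : Measurable F) (hb : ∀ z, |F z| ≤ b) (t : ℕ) (θ : Param d)
    (s : S) : M.rollout F t (θ, s) =
      ∫ s', M.rollout F 0 (θ, s') ∂((M.stateKernel θ ^ t) s) := by
  induction t generalizing s with
  | zero => rw [integral_kernel_pow_zero _ (measurable_rollout_right hF 0 θ)]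
  | succ t ih =>
    rw [integral_kernel_pow_succ _ (measurable_rollout_right hF 0 θ)
      fun s => abs_rollout_le hb 0 (θ, s), rollout,
      integral_jointStep_snd M (θ, s) (measurable_rollout_right hF t θ)
      fun s => abs_rollout_le hb t (θ, s)]
    exact integral_congr_ae (.of_forall ih)

/-- Averaging over the last action leaves a function of the state bounded by `b`, to which mixing
applies. The exponent is `t + 1` because the initial state has time index `1`. -/
theorem abs_rollout_sub_le (herg : M.UniformlyErgodic dstat κ₀ κ) (hF : Measurable F)
    (hb : ∀ z, |F z| ≤ b) (hb₀ : 0 ≤ b) (t : ℕ) (θ : Param d) (s : S) :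
    |M.rollout F t (θ, s) - ∫ x, F (θ, x) ∂(dstat θ ⊗ₘ M.policy θ)| ≤
      2 * b * (κ₀ * κ ^ (t + 1)) := by
  have := herg.isProbability
  have e : ∫ x, F (θ, x) ∂(dstat θ ⊗ₘ M.policy θ) = ∫ s, M.rollout F 0 (θ, s) ∂(dstat θ) := by
    rw [integral_occupancy θ (f := fun x => F (θ, x)) (hF.comp measurable_prodMk_left) fun x => hb (θ, x)]
    simp only [rollout, jointPolicy_apply]
  rw [e, rollout_eq_integral_pow hF hb]
  refine (abs_integral_sub_le_tvDist (measurable_rollout_right hF 0 θ)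
    fun s => abs_rollout_le hb 0 (θ, s)).trans ?_
  gcongr
  exact herg.tvDist_pow_le θ t s

end MDP

/-! ### The actual trajectory against the frozen chain -/

section Trajectory

variable {d : ℕ} {S : Type u} {A : Type v} {Ω : Type w} [MeasurableSpace S] [MeasurableSpace A]
  [mΩ : MeasurableSpace Ω]
  {M : MDP d S A} {γ : ℝ} {n : ℕ} {R : EstimatorKind} {Uf c η₁ r : ℝ} {B : ℕ → ℕ} {F₀ : Finset ℤ}
  {μ : Measure Ω} {ℱ : Filtration ℕ mΩ} {X : Run d S A Ω}
  {Ur UΘ LΘ Uπ κ₀ κ : ℝ} {dstat : Param d → Measure S}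

namespace IsPGVRER

theorem measurable_param_stepIter
    (hX : IsPGVRER M γ n R Uf c η₁ r B F₀ μ ℱ X) (l : ℕ) : Measurable[ℱ l] (X.θ (stepIter n l)) :=
  (hX.param_adapted (l / n)).mono (ℱ.mono (Nat.mul_div_le l n)) le_rfl

theorem measurable_step
    (hX : IsPGVRER M γ n R Uf c η₁ r B F₀ μ ℱ X) (l : ℕ) : Measurable[ℱ (l + 1)] (X.step n l) := by
  have h₁ := (hX.state_adapted l).mono (ℱ.mono (Nat.le_succ l)) le_rfl
  exact h₁.prodMk (hX.action_adapted l)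

/-- Expectations of functions of the past, the action and the next state. -/
theorem integral_step [IsProbabilityMeasure μ]
    (hX : IsPGVRER M γ n R Uf c η₁ r B F₀ μ ℱ X) (l : ℕ) {ϑ : Ω → Param d} (hϑ : Measurable[ℱ l] ϑ)
    {f : (Param d × S) × (A × S) → ℝ} {b : ℝ} (hf : Measurable f) (hb : ∀ z, |f z| ≤ b) :
    ∫ ω, f ((ϑ ω, (X.step n l ω).1), ((X.step n l ω).2, (X.step n (l + 1) ω).1)) ∂μ =
      ∫ ω, ∫ y, f ((ϑ ω, (X.step n l ω).1), y)
        ∂(M.jointStep (X.θ (stepIter n l) ω, (X.step n l ω).1)) ∂μ := by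
  -- Two parameters are recorded: `ϑ`, any parameter known at time `l`, enters only the integrand,
  -- while the transition is governed by the parameter in use.
  let Z : Ω → Param d × (Param d × S) :=
    fun ω => (ϑ ω, (X.θ (stepIter n l) ω, (X.step n l ω).1))
  have hZ : Measurable[ℱ l] Z :=
    hϑ.prodMk ((hX.measurable_param_stepIter l).prodMk (hX.state_adapted l))
  have hZ' : Measurable Z := hZ.mono (ℱ.le l) le_rfl
  let Y : Ω → A × S := fun ω => ((X.step n l ω).2, (X.step n (l + 1) ω).1)
  have hY : Measurable Y := by
    have h₁ := (hX.action_adapted l).mono (ℱ.le _) le_rfl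
    have h₂ := (hX.state_adapted (l + 1)).mono (ℱ.le _) le_rfl
    exact h₁.prodMk h₂
  let η : Kernel (Param d × (Param d × S)) (A × S) := M.jointStep.comap Prod.snd measurable_snd
  have hmap := map_prodMk_eq_compProd (ℱ.le l) hZ hY η fun D hD => by
    refine (hX.law l D hD).trans (.of_forall fun ω => ?_)
    simp only [η, Z, Kernel.comap_apply, MDP.jointStep_apply]
  let f' : (Param d × (Param d × S)) × (A × S) → ℝ := fun z => f ((z.1.1, z.1.2.2), z.2)
  have hf' : Measurable f' := hf.comp (by fun_prop)
  have hprob : IsProbabilityMeasure (μ.map Z) := Measure.isProbabilityMeasure_map hZ'.aemeasurable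
  calc _ = ∫ ω, f' (Z ω, Y ω) ∂μ := rfl
    _ = ∫ z, f' z ∂(μ.map fun ω => (Z ω, Y ω)) :=
      (integral_map (hZ'.prodMk hY).aemeasurable hf'.aestronglyMeasurable).symm
    _ = ∫ z, ∫ y, f' (z, y) ∂(η z) ∂(μ.map Z) := by
      rw [hmap, Measure.integral_compProd (integrable_of_measurable_of_abs_le hf' fun z => hb _)]
    _ = ∫ ω, ∫ y, f' (Z ω, y) ∂(η (Z ω)) ∂μ :=
      integral_map hZ'.aemeasurable
        (measurable_integral_kernel_prod η hf').aestronglyMeasurable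
    _ = _ := by simp only [η, Z, f', Kernel.comap_apply]

variable {F : Param d × (S × A) → ℝ} {b : ℝ}

/-- Starting the rollout one step earlier replaces one transition under the policy in use by one
under the frozen policy `ϑ`, at the price of one perturbation of the state kernel. -/
theorem abs_integral_rollout_step_sub_le [IsProbabilityMeasure μ]
    (hX : IsPGVRER M γ n R Uf c η₁ r B F₀ μ ℱ X) (hreg : M.Regular Ur UΘ LΘ Uπ) (hUπ : 0 ≤ Uπ)
    (hF : Measurable F) (hb : ∀ z, |F z| ≤ b) (hb₀ : 0 ≤ b) {l : ℕ} {ϑ : Ω → Param d}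
    (hϑ : Measurable[ℱ l] ϑ) {ε : ℝ} (hε : ∀ ω, ‖X.θ (stepIter n l) ω - ϑ ω‖ ≤ ε) (t : ℕ) :
    |∫ ω, M.rollout F t (ϑ ω, (X.step n (l + 1) ω).1) ∂μ -
      ∫ ω, M.rollout F (t + 1) (ϑ ω, (X.step n l ω).1) ∂μ| ≤ b * (2 * Uπ * ε) := by
  have hm := MDP.measurable_rollout (M := M) hF t
  have hϑ' : Measurable ϑ := hϑ.mono (ℱ.le _) le_rfl
  have hs : Measurable fun ω => (X.step n l ω).1 := (hX.state_adapted l).mono (ℱ.le _) le_rfl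
  have hp : Measurable (X.θ (stepIter n l)) := (hX.measurable_param_stepIter l).mono (ℱ.le _) le_rfl
  have hf : Measurable fun z : (Param d × S) × (A × S) => M.rollout F t (z.1.1, z.2.2) :=
    hm.comp (by fun_prop)
  have e := hX.integral_step l hϑ hf fun z => MDP.abs_rollout_le hb t _
  rw [e, ← integral_sub]
  · refine abs_integral_le_of_abs_le fun ω => ?_
    rw [MDP.rollout]
    simp only
    rw [MDP.integral_jointStep_snd M _ (MDP.measurable_rollout_right hF t (ϑ ω))
        fun s => MDP.abs_rollout_le hb t _,
      MDP.integral_jointStep_snd M _ (MDP.measurable_rollout_right hF t (ϑ ω))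
        fun s => MDP.abs_rollout_le hb t _]
    refine (hreg.kernelDistLE_stateKernel _ _ _ _ b (MDP.measurable_rollout_right hF t (ϑ ω))
      fun s => MDP.abs_rollout_le hb t _).trans ?_
    gcongr
    exact hε ω
  · refine integrable_of_measurable_of_abs_le (b := b) ?_ fun ω =>
      abs_integral_le_of_abs_le fun y => MDP.abs_rollout_le hb t _
    let η : Kernel (Param d × (Param d × S)) (A × S) := M.jointStep.comap Prod.snd measurable_snd
    have := measurable_integral_kernel_prod η
      (f := fun z : (Param d × (Param d × S)) × (A × S) => M.rollout F t (z.1.1, z.2.2))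
      (hm.comp (by fun_prop))
    exact this.comp (hϑ'.prodMk (hp.prodMk hs))
  · exact integrable_of_measurable_of_abs_le ((MDP.measurable_rollout hF (t + 1)).comp
      (hϑ'.prodMk hs)) fun ω => MDP.abs_rollout_le hb _ _

/-- Exchange of the final action draw, the only place where the action at time `l` itself matters.
-/
theorem abs_integral_pair_sub_le [IsProbabilityMeasure μ]
    (hX : IsPGVRER M γ n R Uf c η₁ r B F₀ μ ℱ X) (hreg : M.Regular Ur UΘ LΘ Uπ) (hUπ : 0 ≤ Uπ)
    (hF : Measurable F) (hb : ∀ z, |F z| ≤ b) (hb₀ : 0 ≤ b) {l : ℕ} {ϑ : Ω → Param d}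
    (hϑ : Measurable[ℱ l] ϑ) {ε : ℝ} (hε : ∀ ω, ‖X.θ (stepIter n l) ω - ϑ ω‖ ≤ ε) :
    |∫ ω, F (ϑ ω, X.step n l ω) ∂μ -
      ∫ ω, M.rollout F 0 (ϑ ω, (X.step n l ω).1) ∂μ| ≤ b * (2 * Uπ * ε) := by
  have hϑ' : Measurable ϑ := hϑ.mono (ℱ.le _) le_rfl
  have hs : Measurable fun ω => (X.step n l ω).1 := (hX.state_adapted l).mono (ℱ.le _) le_rfl
  have hp : Measurable (X.θ (stepIter n l)) := (hX.measurable_param_stepIter l).mono (ℱ.le _) le_rfl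
  have hf : Measurable fun z : (Param d × S) × (A × S) => F (z.1.1, (z.1.2, z.2.1)) :=
    hF.comp (by fun_prop)
  have hFa : ∀ θ s, Measurable fun a => F (θ, (s, a)) := fun θ s => hF.comp (by fun_prop)
  have e := hX.integral_step l hϑ hf fun z => hb _
  simp only [Prod.mk.eta] at e
  rw [e, ← integral_sub]
  · refine abs_integral_le_of_abs_le fun ω => ?_
    rw [MDP.rollout, MDP.jointPolicy_apply, MDP.integral_jointStep_fst M _ (hFa _ _) fun a => hb _]
    refine (hreg.kernelDistLE_policy _ _ _ _ b (hFa _ _) fun a => hb _).trans ?_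
    gcongr
    exact hε ω
  · refine integrable_of_measurable_of_abs_le (b := b) ?_ fun ω =>
      abs_integral_le_of_abs_le fun y => hb _
    let η : Kernel (Param d × (Param d × S)) (A × S) := M.jointStep.comap Prod.snd measurable_snd
    have := measurable_integral_kernel_prod η
      (f := fun z : (Param d × (Param d × S)) × (A × S) => F (z.1.1, (z.1.2.2, z.2.1)))
      (hF.comp (by fun_prop))
    exact this.comp (hϑ'.prodMk (hp.prodMk hs))
  · exact integrable_of_measurable_of_abs_le ((MDP.measurable_rollout hF 0).comp
      (hϑ'.prodMk hs)) fun ω => MDP.abs_rollout_le hb _ _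

/-- Telescoping over the exchange of single transitions: each moves the start back by one and
lengthens the rollout by one, so the endpoint stays fixed. -/
theorem abs_integral_rollout_sub_le [IsProbabilityMeasure μ]
    (hX : IsPGVRER M γ n R Uf c η₁ r B F₀ μ ℱ X) (hreg : M.Regular Ur UΘ LΘ Uπ) (hUπ : 0 ≤ Uπ)
    (hF : Measurable F) (hb : ∀ z, |F z| ≤ b) (hb₀ : 0 ≤ b) {l : ℕ} {ϑ : Ω → Param d}
    (hϑ : Measurable[ℱ l] ϑ) {ε : ℝ} (q t : ℕ)
    (hε : ∀ h, l ≤ h → h < l + t → ∀ ω, ‖X.θ (stepIter n h) ω - ϑ ω‖ ≤ ε) :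
    |∫ ω, M.rollout F q (ϑ ω, (X.step n (l + t) ω).1) ∂μ -
      ∫ ω, M.rollout F (q + t) (ϑ ω, (X.step n l ω).1) ∂μ| ≤ t * (b * (2 * Uπ * ε)) := by
  induction t generalizing q with
  | zero => simp
  | succ t ih =>
    have h₁ := hX.abs_integral_rollout_step_sub_le hreg hUπ hF hb hb₀ (l := l + t)
      (hϑ.mono (ℱ.mono (Nat.le_add_right l t)) le_rfl) (hε (l + t) (by omega) (by omega)) q
    have h₂ := ih (q + 1) fun h hl ht => hε h hl (by omega)
    rw [show q + 1 + t = q + (t + 1) by ring] at h₂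
    calc _ ≤ _ := abs_sub_le _ (∫ ω, M.rollout F (q + 1) (ϑ ω, (X.step n (l + t) ω).1) ∂μ) _
      _ ≤ b * (2 * Uπ * ε) + t * (b * (2 * Uπ * ε)) := add_le_add h₁ h₂
      _ = _ := by push_cast; ring

/-- If the parameters change little during the `t` steps after step `l`, then the pair sampled at
step `l + t` is almost stationary for the policy in use at step `l`. -/
theorem abs_integral_sub_stationary_le [IsProbabilityMeasure μ]
    (hX : IsPGVRER M γ n R Uf c η₁ r B F₀ μ ℱ X) (hreg : M.Regular Ur UΘ LΘ Uπ)
    (herg : M.UniformlyErgodic dstat κ₀ κ) (hUπ : 0 ≤ Uπ)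
    (hF : Measurable F) (hb : ∀ z, |F z| ≤ b) (hb₀ : 0 ≤ b) {l : ℕ} {ϑ : Ω → Param d}
    (hϑ : Measurable[ℱ l] ϑ) {ε : ℝ} (t : ℕ)
    (hε : ∀ h, l ≤ h → h ≤ l + t → ∀ ω, ‖X.θ (stepIter n h) ω - ϑ ω‖ ≤ ε)
    {G : Param d → ℝ} (hG : Measurable G) (hGb : ∀ θ, |G θ| ≤ b)
    (hFG : ∀ θ, ∫ x, F (θ, x) ∂(dstat θ ⊗ₘ M.policy θ) = G θ) :
    |∫ ω, F (ϑ ω, X.step n (l + t) ω) ∂μ - ∫ ω, G (ϑ ω) ∂μ| ≤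
      (t + 1) * (b * (2 * Uπ * ε)) + 2 * b * (κ₀ * κ ^ (t + 1)) := by
  have hϑ' : Measurable ϑ := hϑ.mono (ℱ.le _) le_rfl
  have hs : Measurable fun ω => (X.step n l ω).1 := (hX.state_adapted l).mono (ℱ.le _) le_rfl
  -- One exchanged action (`h₁`) and `t` exchanged transitions (`h₂`) give the factor `t + 1`;
  -- mixing of the frozen chain (`h₃`) gives the last term.
  have h₁ := hX.abs_integral_pair_sub_le hreg hUπ hF hb hb₀ (l := l + t)
      (hϑ.mono (ℱ.mono (Nat.le_add_right l t)) le_rfl) (hε (l + t) (by omega) (by omega))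
  have h₂ := hX.abs_integral_rollout_sub_le hreg hUπ hF hb hb₀ hϑ 0 t
    fun h hl ht => hε h hl (by omega)
  rw [zero_add] at h₂
  have h₃ : |∫ ω, (M.rollout F t (ϑ ω, (X.step n l ω).1) - G (ϑ ω)) ∂μ| ≤
      2 * b * (κ₀ * κ ^ (t + 1)) := by
    refine abs_integral_le_of_abs_le fun ω => ?_
    rw [← hFG]
    exact MDP.abs_rollout_sub_le herg hF hb hb₀ t _ _
  have i₁ : Integrable (fun ω => M.rollout F t (ϑ ω, (X.step n l ω).1)) μ :=
    integrable_of_measurable_of_abs_le ((MDP.measurable_rollout hF t).comp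
      (hϑ'.prodMk hs)) fun ω => MDP.abs_rollout_le hb _ _
  have i₂ : Integrable (fun ω => G (ϑ ω)) μ :=
    integrable_of_measurable_of_abs_le (hG.comp hϑ') fun ω => hGb _
  rw [integral_sub i₁ i₂] at h₃
  have h₄ := abs_sub_le (∫ ω, F (ϑ ω, X.step n (l + t) ω) ∂μ)
    (∫ ω, M.rollout F 0 (ϑ ω, (X.step n (l + t) ω).1) ∂μ) (∫ ω, G (ϑ ω) ∂μ)
  have h₅ := abs_sub_le (∫ ω, M.rollout F 0 (ϑ ω, (X.step n (l + t) ω).1) ∂μ)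
    (∫ ω, M.rollout F t (ϑ ω, (X.step n l ω).1) ∂μ) (∫ ω, G (ϑ ω) ∂μ)
  linarith

end IsPGVRER

end Trajectory

/-! ### Likelihood-ratio weights -/

section Weights

/-- For `b ≤ a`, apply `1 - 1/x ≤ log x` at `x = a / b` and multiply by `a ≤ U`. -/
theorem abs_sub_le_mul_abs_log_sub {a b U : ℝ} (ha : 0 < a) (hb : 0 < b) (haU : a ≤ U)
    (hbU : b ≤ U) : |a - b| ≤ U * |Real.log a - Real.log b| := by
  wlog hab : b ≤ a generalizing a b
  · rw [abs_sub_comm, abs_sub_comm (Real.log a)]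
    exact this hb ha hbU haU (le_of_not_ge hab)
  rw [abs_of_nonneg (sub_nonneg.2 hab),
    abs_of_nonneg (sub_nonneg.2 (Real.log_le_log hb hab)), ← Real.log_div ha.ne' hb.ne']
  have h₁ := Real.one_sub_inv_le_log_of_pos (div_pos ha hb)
  have h₂ : 0 ≤ Real.log (a / b) := Real.log_nonneg ((one_le_div hb).2 hab)
  calc a - b = a * (1 - (a / b)⁻¹) := by field_simp
    _ ≤ a * Real.log (a / b) := mul_le_mul_of_nonneg_left h₁ ha.le
    _ ≤ U * Real.log (a / b) := mul_le_mul_of_nonneg_right haU h₂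

/-- Under the bounded-ratio assumption clipping has no effect on LR, so both kinds are treated at
once with the clipped weight. -/
theorem EstimatorKind.weight_eq_min {R : EstimatorKind} {Uf f : ℝ}
    (h : R = EstimatorKind.LR → f ≤ Uf) : R.weight Uf f = min f Uf := by
  cases R with
  | LR => exact (min_eq_left (h rfl)).symm
  | CLR => rfl

/-- Truncation is 1-Lipschitz on the logarithmic scale. The reference value is `min 1 U` rather than
`1`, since the clipping level may lie below one. -/
theorem abs_min_sub_min_one_le {f U : ℝ} (hf : 0 < f) (hU : 0 < U) :
    |min f U - min 1 U| ≤ U * |Real.log f| := by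
  refine (abs_sub_le_mul_abs_log_sub (lt_min hf hU) (lt_min one_pos hU) (min_le_right _ _)
    (min_le_right _ _)).trans (mul_le_mul_of_nonneg_left ?_ hU.le)
  have hlog : ∀ x : ℝ, 0 < x → Real.log (min x U) = min (Real.log x) (Real.log U) := by
    intro x hx
    rcases le_total x U with h | h
    · rw [min_eq_left h, min_eq_left (Real.log_le_log hx h)]
    · rw [min_eq_right h, min_eq_right (Real.log_le_log hU h)]
  rw [hlog f hf, hlog 1 one_pos, Real.log_one]
  simpa using abs_min_sub_min_le_max (Real.log f) (Real.log U) 0 (Real.log U)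

end Weights

/-! ### Total variance and the ascent inequality -/

theorem totalVariance_nonneg {Ω : Type*} [MeasurableSpace Ω] {d : ℕ} (Z : Ω → Param d)
    (μ : Measure Ω) : 0 ≤ totalVariance Z μ :=
  Finset.sum_nonneg fun _ _ => variance_nonneg _ _

theorem totalVariance_const_smul {Ω : Type*} [MeasurableSpace Ω] {d : ℕ} (a : ℝ) (Z : Ω → Param d)
    (μ : Measure Ω) : totalVariance (fun ω => a • Z ω) μ = a ^ 2 * totalVariance Z μ := by
  simp only [totalVariance, PiLp.smul_apply, smul_eq_mul, variance_const_mul, Finset.mul_sum]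

/-- First-order lower bound for a function with Lipschitz gradient. -/
theorem le_of_gradient_lipschitz {d : ℕ} {J : Param d → ℝ} {L : ℝ}
    (hJ : Differentiable ℝ J) (hL : ∀ θ₁ θ₂, ‖gradient J θ₁ - gradient J θ₂‖ ≤ L * ‖θ₁ - θ₂‖)
    (hL₀ : 0 ≤ L) (x y : Param d) :
    J x + inner ℝ (gradient J x) (y - x) - L * ‖y - x‖ ^ 2 ≤ J y := by
  -- On this ball the derivative differs from the one at `x` by at most `L‖y - x‖`; the mean value
  -- inequality then yields the constant `L` instead of the sharp `L / 2`.
  have h := (convex_closedBall x ‖y - x‖).norm_image_sub_le_of_norm_hasFDerivWithin_le'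
    (f := J) (f' := fderiv ℝ J) (φ := fderiv ℝ J x) (C := L * ‖y - x‖) (x := x) (y := y)
    (fun z _ => (hJ z).hasFDerivAt.hasFDerivWithinAt) (fun z hz => ?_)
    (Metric.mem_closedBall_self (norm_nonneg _)) (by simp [dist_eq_norm])
  · rw [Real.norm_eq_abs] at h
    rw [inner_gradient_left]
    have := (abs_le.1 h).1
    nlinarith
  · rw [← toDual_gradient, ← toDual_gradient, ← map_sub, LinearIsometryEquiv.norm_map]
    refine (hL z x).trans (mul_le_mul_of_nonneg_left ?_ hL₀)
    rwa [mem_closedBall_iff_norm] at hz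

/-- The learning rate `η₁ k^{-r}`. -/
noncomputable def learningRate (η₁ r : ℝ) (k : ℕ) : ℝ := η₁ * (k : ℝ) ^ (-r)

/-! ### Learning rates and summation by parts -/

section LearningRate

variable {η₁ r : ℝ}

theorem learningRate_nonneg (hη : 0 < η₁) (k : ℕ) : 0 ≤ learningRate η₁ r k := by
  unfold learningRate; positivity

theorem learningRate_pos (hη : 0 < η₁) {k : ℕ} (hk : 1 ≤ k) : 0 < learningRate η₁ r k := by
  have : (0 : ℝ) < k := by exact_mod_cast hk
  unfold learningRate; positivity

theorem learningRate_anti (hη : 0 < η₁) (hr : 0 < r) {p q : ℕ} (hp : 1 ≤ p) (hpq : p ≤ q) :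
    learningRate η₁ r q ≤ learningRate η₁ r p := by
  have hp' : (0 : ℝ) < p := by exact_mod_cast hp
  have hpq' : (p : ℝ) ≤ q := by exact_mod_cast hpq
  exact mul_le_mul_of_nonneg_left
    (Real.rpow_le_rpow_of_nonpos hp' hpq' (by linarith)) hη.le

theorem inv_learningRate (η₁ r : ℝ) (k : ℕ) :
    (learningRate η₁ r k)⁻¹ = η₁⁻¹ * (k : ℝ) ^ r := by
  rw [learningRate, mul_inv, Real.rpow_neg (Nat.cast_nonneg k), inv_inv]

theorem inv_learningRate_mono (hη : 0 < η₁) (hr : 0 < r) {p q : ℕ} (hpq : p ≤ q) :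
    (learningRate η₁ r p)⁻¹ ≤ (learningRate η₁ r q)⁻¹ := by
  rw [inv_learningRate, inv_learningRate]
  gcongr

theorem sum_rpow_neg_le (hr₀ : 0 < r) (hr₁ : r < 1) (K : ℕ) :
    ∑ k ∈ Finset.Icc 1 K, (k : ℝ) ^ (-r) ≤ (1 - r)⁻¹ * (K : ℝ) ^ (1 - r) := by
  induction K with
  | zero =>
    have : (0 : ℝ) ≤ (1 - r)⁻¹ := inv_nonneg.2 (by linarith)
    simp only [Finset.Icc_eq_empty_of_lt one_pos, Finset.sum_empty]
    positivity
  | succ K ih =>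
    rw [Finset.sum_Icc_succ_top (Nat.le_add_left 1 K)]
    have hx : (0 : ℝ) < ((K + 1 : ℕ) : ℝ) := by positivity
    set x : ℝ := ((K + 1 : ℕ) : ℝ) with hxdef
    have hK : (K : ℝ) = x * (1 + -(1 / x)) := by
      rw [mul_add, mul_neg, mul_one_div_cancel hx.ne', hxdef]; push_cast; ring
    have hx1 : 1 ≤ x := by rw [hxdef]; push_cast; linarith [Nat.cast_nonneg (α := ℝ) K]
    have hx2 : 1 / x ≤ 1 := by rw [div_le_one hx]; exact hx1
    -- Bernoulli's inequality for the exponent `1 - r`, with `K = x (1 - 1/x)`, bounds the increment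
    -- of `x ^ (1 - r)` from below by `(1 - r) x ^ (-r)`.
    have hB : (1 + -(1 / x)) ^ (1 - r) ≤ 1 + (1 - r) * (-(1 / x)) :=
      rpow_one_add_le_one_add_mul_self (by linarith) (by linarith) (by linarith)
    have hr' : 0 < 1 - r := by linarith
    have e : x ^ (1 - r) * (1 / x) = x ^ (-r) := by
      rw [mul_one_div, ← Real.rpow_sub_one hx.ne']; congr 1; ring
    have hKle : (K : ℝ) ^ (1 - r) ≤ x ^ (1 - r) - (1 - r) * x ^ (-r) := by
      rw [hK, Real.mul_rpow hx.le (by linarith), ← e]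
      calc _ ≤ x ^ (1 - r) * (1 + (1 - r) * (-(1 / x))) :=
            mul_le_mul_of_nonneg_left hB (by positivity)
        _ = _ := by ring
    have := mul_le_mul_of_nonneg_left hKle (inv_nonneg.2 hr'.le)
    rw [mul_sub, inv_mul_cancel_left₀ hr'.ne'] at this
    linarith

theorem sum_learningRate_le (hη : 0 < η₁) (hr₀ : 0 < r) (hr₁ : r < 1) (K : ℕ) :
    ∑ k ∈ Finset.Icc 1 K, learningRate η₁ r k ≤ η₁ * ((1 - r)⁻¹ * (K : ℝ) ^ (1 - r)) := by
  simp only [learningRate, ← Finset.mul_sum]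
  exact mul_le_mul_of_nonneg_left (sum_rpow_neg_le hr₀ hr₁ K) hη.le

/-- Summation of the ascent inequalities `η_k w g_k ≤ a_{k+1} - a_k + η_k (E η_{k-N} + F)`, which
are available for `k > N`, with a crude bound for the first `N` terms. -/
theorem sum_le_of_ascent {a g : ℕ → ℝ} {U H E F w : ℝ} (hη : 0 < η₁) (hr₀ : 0 < r)
    (ha : ∀ k, |a k| ≤ U) (hg : ∀ k, w * g k ≤ H) (hH : 0 ≤ H) (hE : 0 ≤ E) (hF : 0 ≤ F)
    {N K : ℕ} (hasc : ∀ k, N < k → k ≤ K → learningRate η₁ r k * (w * g k) ≤ a (k + 1) - a k +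
      learningRate η₁ r k * (E * learningRate η₁ r (k - N) + F)) :
    ∑ k ∈ Finset.Icc 1 K, w * g k ≤ N * H + (learningRate η₁ r K)⁻¹ * (2 * U) +
      E * ∑ k ∈ Finset.Icc 1 K, learningRate η₁ r k + K * F := by
  have hinv : ∀ k, 0 ≤ (learningRate η₁ r k)⁻¹ := fun k => inv_nonneg.2 (learningRate_nonneg hη k)
  have hU : 0 ≤ U := (abs_nonneg _).trans (ha 0)
  have hshort : ∀ n : ℕ, ∑ k ∈ Finset.Icc 1 n, w * g k ≤ n * H := fun n => by
    simpa using Finset.sum_le_card_nsmul (Finset.Icc 1 n) (fun k => w * g k) H fun k _ => hg k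
  have hsum : 0 ≤ ∑ k ∈ Finset.Icc 1 K, learningRate η₁ r k :=
    Finset.sum_nonneg fun k _ => learningRate_nonneg hη k
  rcases le_total K N with hKN | hNK
  · have h₁ : (K : ℝ) * H ≤ N * H := mul_le_mul_of_nonneg_right (by exact_mod_cast hKN) hH
    have h₂ := hshort K
    have h₃ := mul_nonneg (hinv K) (by linarith : (0 : ℝ) ≤ 2 * U)
    have h₄ := mul_nonneg hE hsum
    have h₅ := mul_nonneg (Nat.cast_nonneg (α := ℝ) K) hF
    linarith
  -- The shift by `U` makes `a + U` nonnegative, so the inverse rate in front of it may be increased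
  -- at every step; this is Abel summation carried as an invariant. The rates `η_{k-N}` are
  -- reindexed to `1, …, t`.
  · have key : ∀ t, N + t ≤ K → ∑ k ∈ Finset.Icc 1 (N + t), w * g k ≤ N * H +
        (learningRate η₁ r (N + t))⁻¹ * (a (N + t + 1) + U) +
        E * ∑ k ∈ Finset.Icc 1 t, learningRate η₁ r k + t * F := by
      intro t
      induction t with
      | zero =>
        intro _
        have h₁ := hshort N
        have h₂ := mul_nonneg (hinv N) (by linarith [(abs_le.1 (ha (N + 1))).1] :
          (0 : ℝ) ≤ a (N + 1) + U)
        simp only [Nat.add_zero, Finset.Icc_eq_empty_of_lt one_pos, Finset.sum_empty,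
          Nat.cast_zero]
        linarith
      | succ t ih =>
        intro hle
        have ih := ih (by omega)
        have hpos : 0 < learningRate η₁ r (N + t + 1) := learningRate_pos hη (by omega)
        have h := hasc (N + t + 1) (by omega) (by omega)
        rw [show N + t + 1 - N = t + 1 by omega] at h
        have h' : w * g (N + t + 1) ≤ (learningRate η₁ r (N + t + 1))⁻¹ *
            (a (N + t + 1 + 1) - a (N + t + 1)) + (E * learningRate η₁ r (t + 1) + F) := by
          have := mul_le_mul_of_nonneg_left h (inv_nonneg.2 hpos.le)
          rw [mul_add, inv_mul_cancel_left₀ hpos.ne', inv_mul_cancel_left₀ hpos.ne'] at this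
          exact this
        have hmono := mul_le_mul_of_nonneg_right
          (inv_learningRate_mono (η₁ := η₁) (r := r) hη hr₀ (Nat.le_succ (N + t)))
          (by linarith [(abs_le.1 (ha (N + t + 1))).1] : (0 : ℝ) ≤ a (N + t + 1) + U)
        rw [← add_assoc, Finset.sum_Icc_succ_top (by omega), Finset.sum_Icc_succ_top (by omega)]
        push_cast
        simp only [Nat.succ_eq_add_one] at hmono
        linarith
    obtain ⟨t, rfl⟩ := Nat.exists_eq_add_of_le hNK
    have h := key t le_rfl
    have h₁ : (learningRate η₁ r (N + t))⁻¹ * (a (N + t + 1) + U) ≤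
        (learningRate η₁ r (N + t))⁻¹ * (2 * U) :=
      mul_le_mul_of_nonneg_left (by linarith [(abs_le.1 (ha (N + t + 1))).2]) (hinv _)
    have h₂ : E * ∑ k ∈ Finset.Icc 1 t, learningRate η₁ r k ≤
        E * ∑ k ∈ Finset.Icc 1 (N + t), learningRate η₁ r k :=
      mul_le_mul_of_nonneg_left (Finset.sum_le_sum_of_subset_of_nonneg
        (Finset.Icc_subset_Icc_right (by omega)) fun k _ _ => learningRate_nonneg hη k) hE
    have h₃ : (t : ℝ) * F ≤ ((N + t : ℕ) : ℝ) * F :=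
      mul_le_mul_of_nonneg_right (by exact_mod_cast Nat.le_add_left t N) hF
    linarith

end LearningRate

theorem norm_average_le {ι E : Type*} [SeminormedAddCommGroup E] [NormedSpace ℝ E] (s : Finset ι)
    {f : ι → E} {C : ℝ} (hC : 0 ≤ C) (h : ∀ i ∈ s, ‖f i‖ ≤ C) :
    ‖(s.card : ℝ)⁻¹ • ∑ i ∈ s, f i‖ ≤ C := by
  rw [norm_smul, norm_inv, Real.norm_natCast]
  have hs : ‖∑ i ∈ s, f i‖ ≤ s.card * C := by
    simpa using norm_sum_le_of_le s h
  -- For an empty set the average is `0`, because `0⁻¹ = 0`.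
  rcases s.card.eq_zero_or_pos with h0 | hpos
  · simpa [h0] using hC
  · have : (0 : ℝ) < s.card := by exact_mod_cast hpos
    calc _ ≤ (s.card : ℝ)⁻¹ * (s.card * C) := by gcongr
      _ = C := inv_mul_cancel_left₀ this.ne' C

theorem le_average {ι : Type*} {s : Finset ι} (hs : s.Nonempty) {f : ι → ℝ} {e : ℝ}
    (h : ∀ i ∈ s, e ≤ f i) : e ≤ (s.card : ℝ)⁻¹ * ∑ i ∈ s, f i := by
  have : (0 : ℝ) < s.card := by exact_mod_cast hs.card_pos
  rw [← inv_mul_cancel_left₀ this.ne' e]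
  gcongr
  simpa using Finset.card_nsmul_le_sum s f e h

/-! ### The pairing of the gradient with scenario gradients -/

section Pairing

variable {d : ℕ} {S : Type u} {A : Type v} [MeasurableSpace S] [MeasurableSpace A]
  {M : MDP d S A} {Ur UΘ LΘ Uπ κ₀ κ γ UJ L b G₀ L₀ : ℝ} {dstat : Param d → Measure S}
  {J : Param d → ℝ}

/-- The inner product of the gradient of the objective with the scenario-based gradient. -/
noncomputable def pairing (M : MDP d S A) (γ : ℝ) (J : Param d → ℝ) (z : Param d × (S × A)) : ℝ :=
  inner ℝ (gradient J z.1) (M.scenarioGrad γ z.1 z.2)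

theorem continuous_gradient_of_lipschitz
    (hL : ∀ θ₁ θ₂, ‖gradient J θ₁ - gradient J θ₂‖ ≤ L * ‖θ₁ - θ₂‖) : Continuous (gradient J) :=
  (LipschitzWith.of_dist_le' (K := L) fun θ₁ θ₂ => by
    rw [dist_eq_norm, dist_eq_norm]; exact hL θ₁ θ₂).continuous

theorem measurable_pairing (hJ : Measurable (gradient J))
    (hg : Measurable fun z : Param d × (S × A) => M.scenarioGrad γ z.1 z.2) :
    Measurable (pairing M γ J) :=
  (hJ.comp measurable_fst).inner hg

theorem abs_pairing_le (hJ : ∀ θ, ‖gradient J θ‖ ≤ G₀) (hg : ∀ θ x, ‖M.scenarioGrad γ θ x‖ ≤ G₀)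
    (z : Param d × (S × A)) : |pairing M γ J z| ≤ G₀ ^ 2 := by
  rw [sq]
  exact (abs_real_inner_le_norm _ _).trans
    (mul_le_mul (hJ _) (hg _ _) (norm_nonneg _) ((norm_nonneg _).trans (hJ z.1)))

theorem abs_pairing_sub_le (hJ : ∀ θ, ‖gradient J θ‖ ≤ G₀)
    (hg : ∀ θ x, ‖M.scenarioGrad γ θ x‖ ≤ G₀)
    (hL : ∀ θ₁ θ₂, ‖gradient J θ₁ - gradient J θ₂‖ ≤ L * ‖θ₁ - θ₂‖)
    (hL₀ : ∀ θ₁ θ₂ x, ‖M.scenarioGrad γ θ₁ x - M.scenarioGrad γ θ₂ x‖ ≤ L₀ * ‖θ₁ - θ₂‖)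
    (θ₁ θ₂ : Param d) (x : S × A) :
    |pairing M γ J (θ₁, x) - pairing M γ J (θ₂, x)| ≤ (G₀ * (L + L₀)) * ‖θ₁ - θ₂‖ := by
  have e : pairing M γ J (θ₁, x) - pairing M γ J (θ₂, x) =
      inner ℝ (gradient J θ₁ - gradient J θ₂) (M.scenarioGrad γ θ₁ x) +
        inner ℝ (gradient J θ₂) (M.scenarioGrad γ θ₁ x - M.scenarioGrad γ θ₂ x) := by
    simp only [pairing, inner_sub_left, inner_sub_right]; ring
  rw [e]
  have h₁ := (abs_real_inner_le_norm (gradient J θ₁ - gradient J θ₂)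
    (M.scenarioGrad γ θ₁ x)).trans (mul_le_mul (hL θ₁ θ₂) (hg θ₁ x) (norm_nonneg _)
      ((norm_nonneg _).trans (hL θ₁ θ₂)))
  have h₂ := (abs_real_inner_le_norm (gradient J θ₂)
    (M.scenarioGrad γ θ₁ x - M.scenarioGrad γ θ₂ x)).trans (mul_le_mul (hJ θ₂) (hL₀ θ₁ θ₂ x)
      (norm_nonneg _) ((norm_nonneg _).trans (hJ θ₂)))
  calc _ ≤ _ := abs_add_le _ _
    _ ≤ _ := add_le_add h₁ h₂
    _ = _ := by ring

theorem abs_sq_norm_gradient_sub_le (hJ : ∀ θ, ‖gradient J θ‖ ≤ G₀)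
    (hL : ∀ θ₁ θ₂, ‖gradient J θ₁ - gradient J θ₂‖ ≤ L * ‖θ₁ - θ₂‖) (θ₁ θ₂ : Param d) :
    |‖gradient J θ₁‖ ^ 2 - ‖gradient J θ₂‖ ^ 2| ≤ 2 * G₀ * L * ‖θ₁ - θ₂‖ := by
  rw [sq_sub_sq, abs_mul, abs_of_nonneg (by positivity)]
  have h := (abs_norm_sub_norm_le (gradient J θ₁) (gradient J θ₂)).trans (hL θ₁ θ₂)
  calc _ ≤ (G₀ + G₀) * (L * ‖θ₁ - θ₂‖) :=
        mul_le_mul (add_le_add (hJ θ₁) (hJ θ₂)) h (abs_nonneg _)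
          (by linarith [(norm_nonneg _).trans (hJ θ₁)])
    _ = _ := by ring

/-- The policy gradient formula enters the ascent argument here: a stationary sample gives an
unbiased ascent direction. -/
theorem integral_pairing (hreg : M.Regular Ur UΘ LΘ Uπ) (herg : M.UniformlyErgodic dstat κ₀ κ)
    (hobj : M.IsObjective γ dstat UJ J) (hγ₀ : 0 ≤ γ) (hγ₁ : γ < 1) (θ : Param d) :
    ∫ x, pairing M γ J (θ, x) ∂(dstat θ ⊗ₘ M.policy θ) = ‖gradient J θ‖ ^ 2 := by
  simp only [pairing]
  rw [← MDP.inner_policyGrad hreg herg hγ₀ hγ₁, ← hobj.gradient_eq, real_inner_self_eq_norm_sq]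

end Pairing

theorem step_mul_add {d n : ℕ} {S A Ω : Type*} (X : Run d S A Ω) {j : ℕ} (hj : j < n) (q : ℕ) :
    X.step n (n * q + j) = X.x (q + 1) j := by
  have hn : 0 < n := by omega
  rw [Run.step, stepIter, Nat.mul_add_mod, Nat.mod_eq_of_lt hj, Nat.mul_add_div hn,
    Nat.div_eq_of_lt hj, add_zero]

theorem norm_indivEstimator_le {d : ℕ} {S A Ω : Type*} [MeasurableSpace S] [MeasurableSpace A]
    {M : MDP d S A} {γ : ℝ} {n : ℕ} {R : EstimatorKind} {Uf G₀ : ℝ} {X : Run d S A Ω} (hUf : 0 < Uf)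
    (hratio : R = EstimatorKind.LR → ∀ θ₁ θ₂ s a, M.dens θ₁ s a / M.dens θ₂ s a ≤ Uf)
    (hg : ∀ θ x, ‖M.scenarioGrad γ θ x‖ ≤ G₀) (i k : ℤ) (ω : Ω) :
    ‖indivEstimator M γ n R Uf X i k ω‖ ≤ Uf * G₀ := by
  have hG₀ : 0 ≤ G₀ := (norm_nonneg _).trans (hg (X.θ 0 ω) (X.x 0 0 ω))
  have h := norm_average_le (Finset.range n) (C := Uf * G₀) (by positivity)
    (f := fun j => R.weight Uf (M.dens (X.θ k ω) (X.x i j ω).1 (X.x i j ω).2 /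
        M.dens (X.θ i ω) (X.x i j ω).1 (X.x i j ω).2) •
      M.scenarioGrad γ (X.θ k ω) (X.x i j ω)) fun j _ => by
      rw [norm_smul, EstimatorKind.weight_eq_min fun hR => hratio hR _ _ _ _, Real.norm_eq_abs,
        abs_of_pos (lt_min (div_pos (M.dens_pos _ _ _) (M.dens_pos _ _ _)) hUf)]
      exact mul_le_mul (min_le_right _ _) (hg _ _) (norm_nonneg _) hUf.le
  rwa [Finset.card_range] at h

/-! ### Drift of the parameters and bias of a reused sample -/

section Trajectory

variable {d : ℕ} {S : Type u} {A : Type v} {Ω : Type w} [MeasurableSpace S] [MeasurableSpace A]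
  [mΩ : MeasurableSpace Ω]
  {M : MDP d S A} {γ : ℝ} {n : ℕ} {R : EstimatorKind} {Uf c η₁ r : ℝ} {B : ℕ → ℕ} {F₀ : Finset ℤ}
  {μ : Measure Ω} {ℱ : Filtration ℕ mΩ} {X : Run d S A Ω}
  {Ur UΘ LΘ Uπ κ₀ κ L G₀ L₀ UJ : ℝ} {dstat : Param d → Measure S} {J : Param d → ℝ}

theorem norm_avgEstimator_le (hUf : 0 < Uf)
    (hratio : R = EstimatorKind.LR → ∀ θ₁ θ₂ s a, M.dens θ₁ s a / M.dens θ₂ s a ≤ Uf)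
    (hg : ∀ θ x, ‖M.scenarioGrad γ θ x‖ ≤ G₀) (k : ℕ) (ω : Ω) :
    ‖avgEstimator M γ n R Uf c B F₀ μ X k ω‖ ≤ Uf * G₀ := by
  have hG₀ : 0 ≤ G₀ := (norm_nonneg _).trans (hg (X.θ 0 ω) (X.x 0 0 ω))
  exact norm_average_le _ (by positivity) fun i _ => norm_indivEstimator_le hUf hratio hg i k ω

/-- The current index always belongs to the reuse set. -/
theorem self_mem_reuseSet (hUf : 0 < Uf) (hc : 1 ≤ c)
    (hratio : R = EstimatorKind.LR → ∀ θ₁ θ₂ s a, M.dens θ₁ s a / M.dens θ₂ s a ≤ Uf)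
    (hB : ∀ k, 1 ≤ B k) {k : ℕ} (hk : 1 ≤ k) :
    (k : ℤ) ∈ reuseSet M γ n R Uf c B F₀ μ X k := by
  have hBk := hB k
  simp only [reuseSet, buffer, Finset.mem_filter, Finset.mem_Ioc]
  refine ⟨⟨⟨by omega, le_rfl⟩, Or.inl (by omega)⟩, ?_⟩
  -- At `i = k` all ratios equal one, so the total variance is that of the classical estimator times
  -- `(min 1 Uf)² ≤ 1 ≤ c`.
  have e : indivEstimator M γ n R Uf X k k =
      fun ω => min 1 Uf • pgEstimator M γ n X k ω := by
    funext ω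
    have hw : ∀ x : S × A, R.weight Uf (M.dens (X.θ k ω) x.1 x.2 / M.dens (X.θ k ω) x.1 x.2) =
        min 1 Uf := fun x => by
      rw [EstimatorKind.weight_eq_min fun hR => hratio hR _ _ _ _, div_self (M.dens_pos _ _ _).ne']
    simp only [indivEstimator, pgEstimator, hw, ← Finset.smul_sum]
    rw [smul_comm]
  rw [e, totalVariance_const_smul]
  refine mul_le_mul_of_nonneg_right ?_ (totalVariance_nonneg _ _)
  have h₁ : min 1 Uf ≤ 1 := min_le_left _ _
  have h₂ : 0 ≤ min 1 Uf := le_min zero_le_one hUf.le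
  nlinarith

namespace IsPGVRER

theorem measurable_param (hX : IsPGVRER M γ n R Uf c η₁ r B F₀ μ ℱ X) (q : ℕ) :
    Measurable (X.θ (q + 1)) :=
  (hX.param_adapted q).mono (ℱ.le _) le_rfl

theorem measurable_sample (hX : IsPGVRER M γ n R Uf c η₁ r B F₀ μ ℱ X) {j : ℕ} (hj : j < n)
    (q : ℕ) : Measurable (X.x (q + 1) j) := by
  rw [← step_mul_add X hj]
  exact (hX.measurable_step _).mono (ℱ.le _) le_rfl

theorem norm_param_succ_sub_le (hX : IsPGVRER M γ n R Uf c η₁ r B F₀ μ ℱ X) (hη : 0 < η₁)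
    (hUf : 0 < Uf)
    (hratio : R = EstimatorKind.LR → ∀ θ₁ θ₂ s a, M.dens θ₁ s a / M.dens θ₂ s a ≤ Uf)
    (hg : ∀ θ x, ‖M.scenarioGrad γ θ x‖ ≤ G₀) {k : ℕ} (hk : 1 ≤ k) (ω : Ω) :
    ‖X.θ (k + 1) ω - X.θ k ω‖ ≤ learningRate η₁ r k * (Uf * G₀) := by
  rw [hX.update k hk ω, add_sub_cancel_left, norm_smul]
  change ‖learningRate η₁ r k‖ * _ ≤ _
  rw [Real.norm_of_nonneg (learningRate_nonneg hη k)]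
  exact mul_le_mul_of_nonneg_left (norm_avgEstimator_le hUf hratio hg k ω)
    (learningRate_nonneg hη k)

/-- The parameters drift slowly. -/
theorem norm_param_add_sub_le (hX : IsPGVRER M γ n R Uf c η₁ r B F₀ μ ℱ X) (hη : 0 < η₁)
    (hr : 0 < r) (hUf : 0 < Uf)
    (hratio : R = EstimatorKind.LR → ∀ θ₁ θ₂ s a, M.dens θ₁ s a / M.dens θ₂ s a ≤ Uf)
    (hg : ∀ θ x, ‖M.scenarioGrad γ θ x‖ ≤ G₀) {p q : ℕ} (hpq : p ≤ q) (t : ℕ) (ω : Ω) :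
    ‖X.θ ((q + t : ℕ) + 1) ω - X.θ (q + 1) ω‖ ≤ t * (learningRate η₁ r (p + 1) * (Uf * G₀)) := by
  have hG₀ : 0 ≤ G₀ := (norm_nonneg _).trans (hg (X.θ 0 ω) (X.x 0 0 ω))
  induction t with
  | zero => simp
  | succ t ih =>
    have h := hX.norm_param_succ_sub_le hη hUf hratio hg (k := q + t + 1) (by omega) ω
    have hanti := mul_le_mul_of_nonneg_right (learningRate_anti (η₁ := η₁) (r := r) hη hr
      (p := p + 1) (q := q + t + 1) (by omega) (by omega)) (by positivity : 0 ≤ Uf * G₀)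
    have e : ((q + (t + 1) : ℕ) : ℤ) = ((q + t + 1 : ℕ) : ℤ) := by push_cast; ring
    have e' : ((q + t + 1 : ℕ) : ℤ) = ((q + t : ℕ) : ℤ) + 1 := by push_cast; ring
    rw [e]
    rw [← e'] at ih
    calc _ ≤ _ := norm_sub_le_norm_sub_add_norm_sub _ (X.θ ((q + t + 1 : ℕ)) ω) _
      _ ≤ _ := add_le_add (h.trans hanti) ih
      _ = _ := by push_cast; ring

/-- Here `θ₁` is the target, `θ₂` the sampling parameter and `θ'` the older parameter to be frozen.
Closeness of `θ₁` to `θ₂` controls the weight, closeness to `θ'` the pairing; both bounds hold for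
every sample. -/
theorem weighted_pairing_ge (hreg : M.Regular Ur UΘ LΘ Uπ) (hUf : 0 < Uf)
    (hratio : R = EstimatorKind.LR → ∀ θ₁ θ₂ s a, M.dens θ₁ s a / M.dens θ₂ s a ≤ Uf)
    (hJ : ∀ θ, ‖gradient J θ‖ ≤ G₀) (hg : ∀ θ x, ‖M.scenarioGrad γ θ x‖ ≤ G₀)
    (hL : ∀ θ₁ θ₂, ‖gradient J θ₁ - gradient J θ₂‖ ≤ L * ‖θ₁ - θ₂‖)
    (hL₀ : ∀ θ₁ θ₂ x, ‖M.scenarioGrad γ θ₁ x - M.scenarioGrad γ θ₂ x‖ ≤ L₀ * ‖θ₁ - θ₂‖)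
    (hUΘ : 0 ≤ UΘ) (hLL₀ : 0 ≤ L + L₀) {θ₁ θ₂ θ' : Param d} {D : ℝ} (h₁₂ : ‖θ₁ - θ₂‖ ≤ D)
    (h₁' : ‖θ₁ - θ'‖ ≤ D) (x : S × A) :
    min 1 Uf * pairing M γ J (θ', x) - (Uf * UΘ * G₀ ^ 2 + G₀ * (L + L₀)) * D ≤
      R.weight Uf (M.dens θ₁ x.1 x.2 / M.dens θ₂ x.1 x.2) * pairing M γ J (θ₁, x) := by
  have hG₀ : 0 ≤ G₀ := (norm_nonneg _).trans (hJ θ₁)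
  rw [EstimatorKind.weight_eq_min fun hR => hratio hR _ _ _ _]
  set w := min (M.dens θ₁ x.1 x.2 / M.dens θ₂ x.1 x.2) Uf
  have hw : |w - min 1 Uf| ≤ Uf * (UΘ * D) := by
    refine (abs_min_sub_min_one_le (div_pos (M.dens_pos _ _ _) (M.dens_pos _ _ _)) hUf).trans ?_
    rw [Real.log_div (M.dens_pos _ _ _).ne' (M.dens_pos _ _ _).ne']
    have := hreg.abs_log_dens_sub_le θ₁ θ₂ x
    gcongr
    exact this.trans (by gcongr)
  have i₁ : |(w - min 1 Uf) * pairing M γ J (θ₁, x)| ≤ Uf * (UΘ * D) * G₀ ^ 2 := by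
    rw [abs_mul]
    exact mul_le_mul hw (abs_pairing_le hJ hg _) (abs_nonneg _) ((abs_nonneg _).trans hw)
  have i₂ : |min 1 Uf * (pairing M γ J (θ₁, x) - pairing M γ J (θ', x))| ≤
      1 * (G₀ * (L + L₀) * D) := by
    rw [abs_mul, abs_of_pos (lt_min one_pos hUf)]
    refine mul_le_mul (min_le_left _ _) ?_ (abs_nonneg _) zero_le_one
    exact (abs_pairing_sub_le hJ hg hL hL₀ θ₁ θ' x).trans (by gcongr)
  have j₁ := (abs_le.1 i₁).1
  have j₂ := (abs_le.1 i₂).1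
  linarith

/-- Lower bound for the expected inner product of the gradient at iteration `p + m + q + 1` with the
contribution of a sample collected in iteration `p + m + 1`; the chain mixes from iteration `p + 1`
on. -/
theorem integral_weighted_pairing_ge [IsProbabilityMeasure μ]
    (hX : IsPGVRER M γ n R Uf c η₁ r B F₀ μ ℱ X)
    (hreg : M.Regular Ur UΘ LΘ Uπ) (herg : M.UniformlyErgodic dstat κ₀ κ)
    (hobj : M.IsObjective γ dstat UJ J) (hγ₀ : 0 ≤ γ) (hγ₁ : γ < 1)
    (hη : 0 < η₁) (hr : 0 < r) (hUf : 0 < Uf) (hUπ : 0 ≤ Uπ) (hκ₀ : 0 ≤ κ₀) (hκ : 0 ≤ κ)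
    (hκ₁ : κ ≤ 1)
    (hratio : R = EstimatorKind.LR → ∀ θ₁ θ₂ s a, M.dens θ₁ s a / M.dens θ₂ s a ≤ Uf)
    (hJ : ∀ θ, ‖gradient J θ‖ ≤ G₀) (hg : ∀ θ x, ‖M.scenarioGrad γ θ x‖ ≤ G₀)
    (hgm : Measurable fun z : Param d × (S × A) => M.scenarioGrad γ z.1 z.2)
    (hL : ∀ θ₁ θ₂, ‖gradient J θ₁ - gradient J θ₂‖ ≤ L * ‖θ₁ - θ₂‖)
    (hL₀ : ∀ θ₁ θ₂ x, ‖M.scenarioGrad γ θ₁ x - M.scenarioGrad γ θ₂ x‖ ≤ L₀ * ‖θ₁ - θ₂‖)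
    (hUΘ : 0 ≤ UΘ) (hLpos : 0 ≤ L) (hL₀pos : 0 ≤ L₀) (p m q : ℕ) {j : ℕ} (hj : j < n) :
    let δ := learningRate η₁ r (p + 1) * (Uf * G₀)
    let i : ℤ := (p + m : ℕ) + 1
    let k : ℤ := (p + m + q : ℕ) + 1
    let f : Ω → ℝ := fun ω => R.weight Uf (M.dens (X.θ k ω) (X.x i j ω).1 (X.x i j ω).2 /
        M.dens (X.θ i ω) (X.x i j ω).1 (X.x i j ω).2) * pairing M γ J (X.θ k ω, X.x i j ω)
    Integrable f μ ∧
    min 1 Uf * ∫ ω, ‖gradient J (X.θ k ω)‖ ^ 2 ∂μ -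
      ((Uf * UΘ * G₀ ^ 2 + G₀ * (L + L₀) + 2 * G₀ * L) * ((m + q : ℕ) * δ) +
        n * (m + 1) * (G₀ ^ 2 * (2 * Uπ * (m * δ))) + 2 * G₀ ^ 2 * (κ₀ * κ ^ (n * m))) ≤
      ∫ ω, f ω ∂μ := by
  intro δ i k f
  obtain ⟨ω₀⟩ := nonempty_of_isProbabilityMeasure μ
  have hG₀ : 0 ≤ G₀ := (norm_nonneg _).trans (hg (X.θ 0 ω₀) (X.x 0 0 ω₀))
  have hδ : 0 ≤ δ := mul_nonneg (learningRate_nonneg hη _) (by positivity)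
  have hJm : Measurable (gradient J) := (continuous_gradient_of_lipschitz hL).measurable
  have hF := measurable_pairing hJm hgm
  have hFb : ∀ z, |pairing M γ J z| ≤ G₀ ^ 2 := abs_pairing_le hJ hg
  have hmk : Measurable (X.θ k) := hX.measurable_param (p + m + q)
  have hmi : Measurable (X.θ i) := hX.measurable_param (p + m)
  have hmx : Measurable (X.x i j) := hX.measurable_sample hj (p + m)
  have hmp : Measurable (X.θ (p + 1)) := hX.measurable_param p
  have drift : ∀ (s t : ℕ) (ω : Ω), p ≤ s → ‖X.θ ((s + t : ℕ) + 1) ω - X.θ (s + 1) ω‖ ≤ t * δ :=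
    fun s t ω hs => hX.norm_param_add_sub_le hη hr hUf hratio hg hs t ω
  set D : ℝ := (m + q : ℕ) * δ with hD
  have hki : ∀ ω, ‖X.θ k ω - X.θ i ω‖ ≤ D := fun ω =>
    (drift (p + m) q ω (by omega)).trans
      (mul_le_mul_of_nonneg_right (by exact_mod_cast Nat.le_add_left q m) hδ)
  have hkp : ∀ ω, ‖X.θ k ω - X.θ (p + 1) ω‖ ≤ D := fun ω => by
    have := drift p (m + q) ω le_rfl
    rwa [← add_assoc] at this
  have hfint : Integrable f μ := by
    refine integrable_of_measurable_of_abs_le (b := Uf * G₀ ^ 2) ?_ fun ω => ?_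
    · refine Measurable.mul ?_ (hF.comp (hmk.prodMk hmx))
      simp only [EstimatorKind.weight_eq_min fun hR => hratio hR _ _ _ _]
      refine Measurable.min (Measurable.div ?_ ?_) measurable_const
      · exact M.measurable_dens.comp (hmk.prodMk hmx)
      · exact M.measurable_dens.comp (hmi.prodMk hmx)
    · simp only [f]
      rw [EstimatorKind.weight_eq_min fun hR => hratio hR _ _ _ _, abs_mul,
        abs_of_pos (lt_min (div_pos (M.dens_pos _ _ _) (M.dens_pos _ _ _)) hUf)]
      exact mul_le_mul (min_le_right _ _) (hFb _) (abs_nonneg _) hUf.le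
  refine ⟨hfint, ?_⟩
  have hGint : ∀ θ : Ω → Param d, Measurable θ →
      Integrable (fun ω => ‖gradient J (θ ω)‖ ^ 2) μ := fun θ hθ =>
    integrable_of_measurable_of_abs_le (b := G₀ ^ 2) ((hJm.comp hθ).norm.pow_const 2) fun ω => by
      rw [abs_of_nonneg (by positivity)]
      exact pow_le_pow_left₀ (norm_nonneg _) (hJ _) 2
  have hFint : Integrable (fun ω => pairing M γ J (X.θ (p + 1) ω, X.x i j ω)) μ :=
    integrable_of_measurable_of_abs_le (hF.comp (hmp.prodMk hmx)) fun ω => hFb _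
  have s₁ : min 1 Uf * (∫ ω, pairing M γ J (X.θ (p + 1) ω, X.x i j ω) ∂μ) -
      (Uf * UΘ * G₀ ^ 2 + G₀ * (L + L₀)) * D ≤ ∫ ω, f ω ∂μ := by
    have h := integral_mono ((hFint.const_mul (min 1 Uf)).sub (integrable_const
      ((Uf * UΘ * G₀ ^ 2 + G₀ * (L + L₀)) * D))) hfint fun ω =>
      weighted_pairing_ge hreg hUf hratio hJ hg hL hL₀ hUΘ (by linarith) (hki ω) (hkp ω) (X.x i j ω)
    simp only [Pi.sub_apply] at h
    rw [integral_sub (hFint.const_mul _) (integrable_const _), integral_const_mul] at h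
    simpa using h
  -- `θ_{p+1}` is known at time `n * p`, and the sample is taken `n * m + j` steps later.
  have s₂ := hX.abs_integral_sub_stationary_le hreg herg hUπ hF hFb (by positivity)
    (l := n * p) (ϑ := X.θ (p + 1)) (hX.param_adapted p) (ε := m * δ) (n * m + j)
    (fun h hl ht ω => by
      have hn : 0 < n := by omega
      -- The steps in between belong to the iterations `p + 1, …, p + m + 1`, hence at most `m`
      -- updates separate their parameters from `θ_{p+1}`.
      have h₁ : p ≤ h / n := by rw [Nat.le_div_iff_mul_le hn]; linarith
      have h₂ : h / n ≤ p + m := by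
        rw [← Nat.lt_succ_iff, Nat.div_lt_iff_lt_mul hn]
        calc h ≤ n * p + (n * m + j) := ht
          _ < n * p + (n * m + n) := by omega
          _ = _ := by rw [Nat.succ_eq_add_one]; ring
      obtain ⟨t, ht'⟩ := Nat.exists_eq_add_of_le h₁
      rw [stepIter, ht']
      refine (drift p t ω le_rfl).trans (mul_le_mul_of_nonneg_right ?_ hδ)
      exact_mod_cast (by omega : t ≤ m))
    (G := fun θ => ‖gradient J θ‖ ^ 2) (hJm.norm.pow_const 2) (fun θ => by
      rw [abs_of_nonneg (by positivity)]
      exact pow_le_pow_left₀ (norm_nonneg _) (hJ _) 2)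
    (integral_pairing hreg herg hobj hγ₀ hγ₁)
  rw [show n * p + (n * m + j) = n * (p + m) + j by ring, step_mul_add X hj] at s₂
  -- Return from the frozen parameter to `θ_k`; this accounts for the term `2 * G₀ * L` in the drift
  -- coefficient.
  have s₃ : |∫ ω, (‖gradient J (X.θ k ω)‖ ^ 2 - ‖gradient J (X.θ (p + 1) ω)‖ ^ 2) ∂μ| ≤
      2 * G₀ * L * D := by
    refine abs_integral_le_of_abs_le fun ω => ?_
    exact (abs_sq_norm_gradient_sub_le hJ hL _ _).trans
      (mul_le_mul_of_nonneg_left (hkp ω) (by positivity))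
  rw [integral_sub (hGint _ hmk) (hGint _ hmp)] at s₃
  have hw₁ : min 1 Uf ≤ 1 := min_le_left _ _
  have hw₀ : 0 < min 1 Uf := lt_min one_pos hUf
  have hj' : ((n * m + j : ℕ) : ℝ) + 1 ≤ n * (m + 1) := by
    exact_mod_cast (by rw [mul_add]; omega : n * m + j + 1 ≤ n * (m + 1))
  have hκpow : κ ^ (n * m + j + 1) ≤ κ ^ (n * m) := pow_le_pow_of_le_one hκ hκ₁ (by omega)
  have t₁ : (((n * m + j : ℕ) : ℝ) + 1) * (G₀ ^ 2 * (2 * Uπ * (m * δ))) ≤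
      n * (m + 1) * (G₀ ^ 2 * (2 * Uπ * (m * δ))) :=
    mul_le_mul_of_nonneg_right hj' (by positivity)
  have t₂ : 2 * G₀ ^ 2 * (κ₀ * κ ^ (n * m + j + 1)) ≤ 2 * G₀ ^ 2 * (κ₀ * κ ^ (n * m)) := by
    gcongr
  set a₁ := ∫ ω, ‖gradient J (X.θ k ω)‖ ^ 2 ∂μ
  set a₂ := ∫ ω, ‖gradient J (X.θ (p + 1) ω)‖ ^ 2 ∂μ
  set a₃ := ∫ ω, pairing M γ J (X.θ (p + 1) ω, X.x i j ω) ∂μ with ha₃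
  set E₁ := n * (m + 1) * (G₀ ^ 2 * (2 * Uπ * (m * δ)))
  set E₂ := 2 * G₀ ^ 2 * (κ₀ * κ ^ (n * m))
  have u₂ := (abs_le.1 s₂).1
  have u₃ := (abs_le.1 s₃).2
  have hge : a₁ - (2 * G₀ * L * D + E₁ + E₂) ≤ a₃ := by
    have : a₃ - a₂ ≥ -(((n * m + j : ℕ) + 1) * (G₀ ^ 2 * (2 * Uπ * (m * δ))) +
      2 * G₀ ^ 2 * (κ₀ * κ ^ (n * m + j + 1))) := u₂
    linarith
  have hE : 0 ≤ 2 * G₀ * L * D + E₁ + E₂ := by positivity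
  have v₁ := mul_le_mul_of_nonneg_left hge hw₀.le
  have v₂ := mul_le_mul_of_nonneg_right hw₁ hE
  rw [mul_sub] at v₁
  linarith

end IsPGVRER

end Trajectory

theorem inner_indivEstimator {d : ℕ} {S A Ω : Type*} [MeasurableSpace S] [MeasurableSpace A]
    {M : MDP d S A} {γ : ℝ} {n : ℕ} {R : EstimatorKind} {Uf : ℝ} {X : Run d S A Ω} (J : Param d → ℝ) (i k : ℤ) (ω : Ω) :
    inner ℝ (gradient J (X.θ k ω)) (indivEstimator M γ n R Uf X i k ω) =
      (n : ℝ)⁻¹ * ∑ j ∈ Finset.range n,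
        R.weight Uf (M.dens (X.θ k ω) (X.x i j ω).1 (X.x i j ω).2 /
          M.dens (X.θ i ω) (X.x i j ω).1 (X.x i j ω).2) * pairing M γ J (X.θ k ω, X.x i j ω) := by
  simp only [indivEstimator, inner_smul_right, inner_sum, pairing]

/-! ### Expected ascent in one iteration -/

section Ascent

variable {d : ℕ} {S : Type u} {A : Type v} {Ω : Type w} [MeasurableSpace S] [MeasurableSpace A]
  [mΩ : MeasurableSpace Ω]
  {M : MDP d S A} {γ : ℝ} {n : ℕ} {R : EstimatorKind} {Uf c η₁ r : ℝ} {B : ℕ → ℕ} {F₀ : Finset ℤ}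
  {μ : Measure Ω} {ℱ : Filtration ℕ mΩ} {X : Run d S A Ω}
  {Ur UΘ LΘ Uπ κ₀ κ L G₀ L₀ UJ : ℝ} {dstat : Param d → Measure S} {J : Param d → ℝ}

/-- Constant that controls the effect of the drift of the parameters on the bias. -/
noncomputable def biasConst (Uf UΘ G₀ L L₀ : ℝ) : ℝ :=
  Uf * UΘ * G₀ ^ 2 + G₀ * (L + L₀) + 2 * G₀ * L

/-- Expected ascent in an iteration whose buffer reaches back at most `N - m` iterations. -/
theorem IsPGVRER.expected_ascent [IsProbabilityMeasure μ]
    (hX : IsPGVRER M γ n R Uf c η₁ r B F₀ μ ℱ X) (hn : 1 ≤ n)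
    (hreg : M.Regular Ur UΘ LΘ Uπ) (herg : M.UniformlyErgodic dstat κ₀ κ)
    (hobj : M.IsObjective γ dstat UJ J) (hγ₀ : 0 ≤ γ) (hγ₁ : γ < 1) (hc : 1 ≤ c)
    (hη : 0 < η₁) (hr : 0 < r) (hUf : 0 < Uf) (hUπ : 0 ≤ Uπ) (hκ₀ : 0 ≤ κ₀) (hκ : 0 ≤ κ)
    (hκ₁ : κ ≤ 1) (hB : ∀ k, 1 ≤ B k)
    (hratio : R = EstimatorKind.LR → ∀ θ₁ θ₂ s a, M.dens θ₁ s a / M.dens θ₂ s a ≤ Uf)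
    (hJ : ∀ θ, ‖gradient J θ‖ ≤ G₀) (hg : ∀ θ x, ‖M.scenarioGrad γ θ x‖ ≤ G₀)
    (hgm : Measurable fun z : Param d × (S × A) => M.scenarioGrad γ z.1 z.2)
    (hL : ∀ θ₁ θ₂, ‖gradient J θ₁ - gradient J θ₂‖ ≤ L * ‖θ₁ - θ₂‖)
    (hL₀ : ∀ θ₁ θ₂ x, ‖M.scenarioGrad γ θ₁ x - M.scenarioGrad γ θ₂ x‖ ≤ L₀ * ‖θ₁ - θ₂‖)
    (hUΘ : 0 ≤ UΘ) (hLpos : 0 ≤ L) (hL₀pos : 0 ≤ L₀) {k m N : ℕ} (hN : B k + m ≤ N)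
    (hk : N < k) :
    learningRate η₁ r k * (min 1 Uf * ∫ ω, ‖gradient J (X.θ k ω)‖ ^ 2 ∂μ) ≤
      ∫ ω, J (X.θ (k + 1 : ℕ) ω) ∂μ - ∫ ω, J (X.θ k ω) ∂μ + learningRate η₁ r k *
        ((biasConst Uf UΘ G₀ L L₀ * (N * (Uf * G₀)) +
          n * (m + 1) * (G₀ ^ 2 * (2 * Uπ * (m * (Uf * G₀)))) + L * (Uf * G₀) ^ 2) *
            learningRate η₁ r (k - N) + 2 * G₀ ^ 2 * (κ₀ * κ ^ (n * m))) := by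
  obtain ⟨ω₀⟩ := nonempty_of_isProbabilityMeasure μ
  have hG₀ : 0 ≤ G₀ := (norm_nonneg _).trans (hg (X.θ 0 ω₀) (X.x 0 0 ω₀))
  set U := reuseSet M γ n R Uf c B F₀ μ X k with hU
  set η := learningRate η₁ r (k - N) with hηdef
  have hη₀ : 0 ≤ η := learningRate_nonneg hη _
  have hne : U.Nonempty := ⟨k, self_mem_reuseSet hUf hc hratio hB (by omega)⟩
  set e : ℝ := min 1 Uf * ∫ ω, ‖gradient J (X.θ k ω)‖ ^ 2 ∂μ -
    (biasConst Uf UΘ G₀ L L₀ * (N * (η * (Uf * G₀))) +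
      n * (m + 1) * (G₀ ^ 2 * (2 * Uπ * (m * (η * (Uf * G₀))))) +
      2 * G₀ ^ 2 * (κ₀ * κ ^ (n * m))) with he
  have hbias : 0 ≤ biasConst Uf UΘ G₀ L L₀ := by unfold biasConst; positivity
  have hindiv : ∀ i ∈ U,
      Integrable (fun ω => inner ℝ (gradient J (X.θ k ω)) (indivEstimator M γ n R Uf X i k ω)) μ ∧
      e ≤ ∫ ω, inner ℝ (gradient J (X.θ k ω)) (indivEstimator M γ n R Uf X i k ω) ∂μ := by
    intro i hi
    simp only [hU, reuseSet, buffer, Finset.mem_filter, Finset.mem_Ioc] at hi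
    obtain ⟨⟨⟨hi₁, hi₂⟩, -⟩, -⟩ := hi
    -- `N < k` and `i > k - B k` leave room for `m` iterations of the run before `i`; in particular
    -- `i` is not from the initial stock. Moreover `p + 1 > k - N`, so the rate at `k - N` dominates
    -- all rates since then, and `m + q ≤ N`.
    obtain ⟨p, hp⟩ : ∃ p : ℕ, i = (p + m : ℕ) + 1 := ⟨(i - m - 1).toNat, by omega⟩
    obtain ⟨q, hq⟩ : ∃ q : ℕ, (k : ℤ) = (p + m + q : ℕ) + 1 := ⟨(k - i).toNat, by omega⟩
    have key := fun j (hj : j < n) => hX.integral_weighted_pairing_ge hreg herg hobj hγ₀ hγ₁ hη hr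
      hUf hUπ hκ₀ hκ hκ₁ hratio hJ hg hgm hL hL₀ hUΘ hLpos hL₀pos p m q hj
    simp only [← hp, ← hq] at key
    have hδ : learningRate η₁ r (p + 1) ≤ η := learningRate_anti hη hr (by omega) (by omega)
    have hmq : ((m + q : ℕ) : ℝ) ≤ N := by exact_mod_cast (by omega : m + q ≤ N)
    simp only [inner_indivEstimator]
    refine ⟨(integrable_finsetSum _ fun j hj =>
      (key j (Finset.mem_range.1 hj)).1).const_mul _, ?_⟩
    rw [integral_const_mul, integral_finsetSum _ fun j hj => (key j (Finset.mem_range.1 hj)).1]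
    have hcard : (n : ℝ)⁻¹ = ((Finset.range n).card : ℝ)⁻¹ := by rw [Finset.card_range]
    rw [hcard]
    refine le_average (by simpa using (by omega : n ≠ 0)) fun j hj => ?_
    refine le_trans ?_ (key j (Finset.mem_range.1 hj)).2
    have hδ' : learningRate η₁ r (p + 1) * (Uf * G₀) ≤ η * (Uf * G₀) := by gcongr
    have hδ₀ : 0 ≤ learningRate η₁ r (p + 1) * (Uf * G₀) :=
      mul_nonneg (learningRate_nonneg hη _) (by positivity)
    rw [he]
    refine sub_le_sub_left ?_ _
    refine add_le_add (add_le_add ?_ ?_) le_rfl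
    · exact mul_le_mul_of_nonneg_left (mul_le_mul hmq hδ' hδ₀ (Nat.cast_nonneg N)) hbias
    · gcongr
  -- `U` does not depend on `ω`, so the expectation passes through the average and the common lower
  -- bound `e` survives.
  have havg : ∀ ω, inner ℝ (gradient J (X.θ k ω)) (avgEstimator M γ n R Uf c B F₀ μ X k ω) =
      (U.card : ℝ)⁻¹ *
        ∑ i ∈ U, inner ℝ (gradient J (X.θ k ω)) (indivEstimator M γ n R Uf X i k ω) := by
    intro ω
    simp only [avgEstimator, inner_smul_right, inner_sum, ← hU]
  have havgint : Integrable (fun ω => inner ℝ (gradient J (X.θ k ω))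
      (avgEstimator M γ n R Uf c B F₀ μ X k ω)) μ := by
    simp only [havg]
    exact (integrable_finsetSum _ fun i hi => (hindiv i hi).1).const_mul _
  have havgle : e ≤ ∫ ω, inner ℝ (gradient J (X.θ k ω))
      (avgEstimator M γ n R Uf c B F₀ μ X k ω) ∂μ := by
    simp only [havg]
    rw [integral_const_mul, integral_finsetSum _ fun i hi => (hindiv i hi).1]
    exact le_average hne fun i hi => (hindiv i hi).2
  have hJd : Differentiable ℝ J := fun θ => (hobj.hasGradientAt θ).differentiableAt
  have hJm : ∀ q : ℕ, Integrable (fun ω => J (X.θ (q + 1) ω)) μ := fun q =>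
    integrable_of_measurable_of_abs_le (hJd.continuous.measurable.comp (hX.measurable_param q))
      fun ω => hobj.abs_le _
  have hJk : Integrable (fun ω => J (X.θ k ω)) μ := by
    have := hJm (k - 1)
    rwa [show ((k - 1 : ℕ) : ℤ) + 1 = k by omega] at this
  have hJk₁ : Integrable (fun ω => J (X.θ (k + 1 : ℕ) ω)) μ := by
    simpa using hJm k
  set ηk := learningRate η₁ r k with hηk
  have hηk₀ : 0 ≤ ηk := learningRate_nonneg hη _
  have hηkη : ηk ≤ η := learningRate_anti hη hr (by omega) (by omega)
  have hpt : ∀ ω, J (X.θ k ω) + ηk * inner ℝ (gradient J (X.θ k ω))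
      (avgEstimator M γ n R Uf c B F₀ μ X k ω) - L * (ηk * (Uf * G₀)) ^ 2 ≤
        J (X.θ (k + 1 : ℕ) ω) := by
    intro ω
    have h₁ := le_of_gradient_lipschitz hJd hL hLpos (X.θ k ω) (X.θ (k + 1) ω)
    have h₂ := hX.norm_param_succ_sub_le hη hUf hratio hg (k := k) (by omega) ω
    have h₃ : X.θ (k + 1) ω - X.θ k ω = ηk • avgEstimator M γ n R Uf c B F₀ μ X k ω := by
      rw [hX.update k (by omega) ω, add_sub_cancel_left]
      rfl
    have h₄ := mul_le_mul_of_nonneg_left (pow_le_pow_left₀ (norm_nonneg _) h₂ 2) hLpos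
    rw [h₃, inner_smul_right] at h₁
    rw [h₃] at h₄
    push_cast
    linarith
  have hsum : Integrable (fun ω => J (X.θ k ω) + ηk * inner ℝ (gradient J (X.θ k ω))
      (avgEstimator M γ n R Uf c B F₀ μ X k ω)) μ := hJk.add (havgint.const_mul ηk)
  have hint := integral_mono (hsum.sub (integrable_const (L * (ηk * (Uf * G₀)) ^ 2))) hJk₁ hpt
  simp only [Pi.sub_apply] at hint
  rw [integral_sub hsum (integrable_const _),
    integral_add hJk (havgint.const_mul ηk), integral_const_mul, integral_const] at hint
  simp only [probReal_univ, one_smul] at hint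
  have h₁ := mul_le_mul_of_nonneg_left havgle hηk₀
  -- One of the two factors `ηk` is enlarged to `η`, so that the second-order term joins the bias
  -- with the same rate `η_{k-N}`.
  have h₂ : L * (ηk * (Uf * G₀)) ^ 2 ≤ ηk * (L * (Uf * G₀) ^ 2 * η) := by
    calc L * (ηk * (Uf * G₀)) ^ 2 = ηk * (L * (Uf * G₀) ^ 2 * ηk) := by ring
      _ ≤ _ := by gcongr
  rw [he, mul_sub] at h₁
  have h₃ : ηk * (min 1 Uf * ∫ ω, ‖gradient J (X.θ k ω)‖ ^ 2 ∂μ) ≤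
      ∫ ω, J (X.θ (k + 1 : ℕ) ω) ∂μ - ∫ ω, J (X.θ k ω) ∂μ + ηk * (L * (Uf * G₀) ^ 2 * η) +
      ηk * (biasConst Uf UΘ G₀ L L₀ * (N * (η * (Uf * G₀))) +
        n * (m + 1) * (G₀ ^ 2 * (2 * Uπ * (m * (η * (Uf * G₀))))) +
        2 * G₀ ^ 2 * (κ₀ * κ ^ (n * m))) := by linarith
  refine h₃.trans (le_of_eq ?_)
  ring

end Ascent

/-! ### The mixing lag and the limit of the rate -/

section Rate

theorem mixingLag_nonneg {κ r : ℝ} (hκ : 0 < κ) (hκ₁ : κ < 1) (hr : 0 < r) (n : ℕ) {K : ℕ}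
    (hK : 1 ≤ K) : 0 ≤ mixingLag κ r n K := by
  have hK' : (1 : ℝ) ≤ K := by exact_mod_cast hK
  refine Real.logb_nonneg_of_base_lt_one hκ hκ₁ (by positivity) ?_
  exact Real.rpow_le_one_of_one_le_of_nonpos hK' (by simp only [Left.neg_nonpos_iff]; positivity)

theorem mixingLag_eq (κ r : ℝ) (n : ℕ) {K : ℕ} (hK : 1 ≤ K) :
    mixingLag κ r n K = (-(r / n) / Real.log κ) * Real.log K := by
  have hK' : (0 : ℝ) < K := by exact_mod_cast hK
  rw [mixingLag, Real.logb, Real.log_rpow hK']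
  ring

/-- At the real-valued lag there is equality; rounding up only decreases the power, as `κ < 1`. -/
theorem pow_ceil_mixingLag_le {κ r : ℝ} (hκ : 0 < κ) (hκ₁ : κ < 1) {n : ℕ}
    (hn : 1 ≤ n) {K : ℕ} (hK : 1 ≤ K) :
    κ ^ (n * ⌈mixingLag κ r n K⌉₊) ≤ (K : ℝ) ^ (-r) := by
  have hK' : (0 : ℝ) < K := by exact_mod_cast hK
  have hn' : (0 : ℝ) < n := by exact_mod_cast hn
  have h : κ ^ ((n : ℝ) * mixingLag κ r n K) = (K : ℝ) ^ (-r) := by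
    rw [mul_comm, Real.rpow_mul hκ.le, mixingLag, Real.rpow_logb hκ hκ₁.ne (by positivity),
      ← Real.rpow_mul hK'.le]
    congr 1
    field_simp
  rw [← h, ← Real.rpow_natCast]
  refine Real.rpow_le_rpow_of_exponent_ge hκ hκ₁.le ?_
  push_cast
  exact mul_le_mul_of_nonneg_left (Nat.le_ceil _) hn'.le

theorem tendsto_log_pow_div_rpow {r : ℝ} (hr : 0 < r) (a : ℕ) :
    Tendsto (fun K : ℕ => Real.log K ^ a / (K : ℝ) ^ r) atTop (𝓝 0) := by
  have h := (isLittleO_log_rpow_rpow_atTop (a : ℝ) hr).tendsto_div_nhds_zero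
  simp only [Real.rpow_natCast] at h
  exact h.comp tendsto_natCast_atTop_atTop

/-- The right-hand side of the rate tends to zero if the buffer grows slowly. -/
theorem tendsto_rate {κ r C : ℝ} (hr₀ : 0 < r) (hr₁ : r < 1) (n : ℕ) {B : ℕ → ℕ}
    (hB : Tendsto (fun K : ℕ => (B K : ℝ) / (K : ℝ) ^ r) atTop (𝓝 0)) :
    Tendsto (fun K : ℕ => C * (1 / (K : ℝ) ^ (1 - r) + mixingLag κ r n K ^ 2 / (K : ℝ) ^ r +
      (B K + mixingLag κ r n K) / (K : ℝ) ^ r)) atTop (𝓝 0) := by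
  -- The exponent `0` of the logarithm yields `1 / K ^ (1 - r)`; the lag is a multiple of `log K`,
  -- so the exponents `2` and `1` handle its two occurrences.
  have h₁ := tendsto_log_pow_div_rpow (r := 1 - r) (by linarith) 0
  have h₂ := (tendsto_log_pow_div_rpow hr₀ 2).const_mul ((-(r / n) / Real.log κ) ^ 2)
  have h₃ := (tendsto_log_pow_div_rpow hr₀ 1).const_mul (-(r / n) / Real.log κ)
  have h := ((h₁.add h₂).add (hB.add h₃)).const_mul C
  simp only [mul_zero, add_zero] at h
  refine h.congr' ?_
  filter_upwards [eventually_ge_atTop 1] with K hK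
  rw [mixingLag_eq κ r n hK]
  ring

end Rate

/-! ### The explicit constant and the rate -/

section Rate

/-- The factor of `N + (m + 1)²` in the coefficient of the squared learning rates. -/
noncomputable def driftConst (n : ℕ) (Uf UΘ Uπ G₀ L L₀ : ℝ) : ℝ :=
  biasConst Uf UΘ G₀ L L₀ * (Uf * G₀) + n * (G₀ ^ 2 * (2 * Uπ * (Uf * G₀))) + L * (Uf * G₀) ^ 2

theorem driftConst_mul_ge {Uf UΘ Uπ G₀ L L₀ x N : ℝ} (hUf : 0 < Uf) (hUΘ : 0 ≤ UΘ) (hUπ : 0 ≤ Uπ)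
    (hG₀ : 0 ≤ G₀) (hL : 0 ≤ L) (hL₀ : 0 ≤ L₀) (n : ℕ) (hx : 0 ≤ x) (hN : 1 ≤ N) :
    biasConst Uf UΘ G₀ L L₀ * (N * (Uf * G₀)) +
      n * (x + 1) * (G₀ ^ 2 * (2 * Uπ * (x * (Uf * G₀)))) + L * (Uf * G₀) ^ 2 ≤
      driftConst n Uf UΘ Uπ G₀ L L₀ * (N + (x + 1) ^ 2) := by
  have hbias : 0 ≤ biasConst Uf UΘ G₀ L L₀ := by unfold biasConst; positivity
  have hsq : 0 ≤ (x + 1) ^ 2 := sq_nonneg _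
  have h₁ : 0 ≤ biasConst Uf UΘ G₀ L L₀ * (Uf * G₀) := by positivity
  have h₂ : 0 ≤ n * (G₀ ^ 2 * (2 * Uπ * (Uf * G₀))) := by positivity
  have h₃ : 0 ≤ L * (Uf * G₀) ^ 2 := by positivity
  have hx₂ : (x + 1) * x ≤ N + (x + 1) ^ 2 := by
    have : (x + 1) ^ 2 = (x + 1) * x + x + 1 := by ring
    linarith
  have e₁ := mul_le_mul_of_nonneg_left (by linarith : N ≤ N + (x + 1) ^ 2) h₁
  have e₂ := mul_le_mul_of_nonneg_left hx₂ h₂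
  have e₃ := mul_le_mul_of_nonneg_left (by linarith : 1 ≤ N + (x + 1) ^ 2) h₃
  rw [driftConst, add_mul, add_mul]
  refine add_le_add (add_le_add ?_ ?_) ?_
  · exact (le_of_eq (by ring)).trans e₁
  · exact (le_of_eq (by ring)).trans e₂
  · exact (le_of_eq (by ring)).trans e₃

/-- The constant in the rate of convergence. -/
noncomputable def rateConst (n : ℕ) (Uf UΘ Uπ G₀ L L₀ κ₀ UJ η₁ r : ℝ) : ℝ :=
  (min 1 Uf)⁻¹ * (2 * UJ * η₁⁻¹ + 2 * (min 1 Uf * G₀ ^ 2) +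
    10 * (driftConst n Uf UΘ Uπ G₀ L L₀ * (η₁ * (1 - r)⁻¹)) + 4 * (G₀ ^ 2 * κ₀))

/-- With `y = K ^ r`, `z = K ^ (1 - r)` and `T = t² + Bk + t`, every contribution is at most a
constant times `y` or `T * z`; division by `K = y * z` turns these into `1 / z` and `T / y`. -/
theorem rate_of_sum_le {n m N Bk K : ℕ} {Uf UΘ Uπ G₀ L L₀ κ₀ UJ η₁ r F t s : ℝ}
    (hUf : 0 < Uf) (hUΘ : 0 ≤ UΘ) (hUπ : 0 ≤ Uπ) (hG₀ : 0 ≤ G₀) (hL : 0 ≤ L) (hL₀ : 0 ≤ L₀)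
    (hκ₀ : 0 ≤ κ₀) (hUJ : 0 ≤ UJ) (hη : 0 < η₁) (hr₀ : 0 < r) (hr₁ : r < 1)
    (ht : 0 ≤ t) (hm : (m : ℝ) ≤ t + 1) (hN : N = Bk + m) (hB : 1 ≤ Bk) (hK : 1 ≤ K)
    (hF : F ≤ 2 * G₀ ^ 2 * (κ₀ * (K : ℝ) ^ (-r)))
    (h : min 1 Uf * s ≤ N * (min 1 Uf * G₀ ^ 2) + (learningRate η₁ r K)⁻¹ * (2 * UJ) +
      (biasConst Uf UΘ G₀ L L₀ * (N * (Uf * G₀)) +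
          n * (m + 1) * (G₀ ^ 2 * (2 * Uπ * (m * (Uf * G₀)))) + L * (Uf * G₀) ^ 2) *
        ∑ k ∈ Finset.Icc 1 K, learningRate η₁ r k + K * F) :
    1 / (K : ℝ) * s ≤ rateConst n Uf UΘ Uπ G₀ L L₀ κ₀ UJ η₁ r *
      (1 / (K : ℝ) ^ (1 - r) + t ^ 2 / (K : ℝ) ^ r + (Bk + t) / (K : ℝ) ^ r) := by
  have hw : 0 < min 1 Uf := lt_min one_pos hUf
  set w := min 1 Uf with hwdef
  have hK₁ : (1 : ℝ) ≤ K := by exact_mod_cast hK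
  have hK₀ : (0 : ℝ) < K := by linarith
  have hr₁' : 0 < 1 - r := by linarith
  set y : ℝ := (K : ℝ) ^ r with hy
  set z : ℝ := (K : ℝ) ^ (1 - r) with hz
  have hypos : 0 < y := by positivity
  have hz₁ : 1 ≤ z := Real.one_le_rpow hK₁ hr₁'.le
  have hzpos : 0 < z := by linarith
  have hyz : (K : ℝ) = y * z := by
    rw [hy, hz, ← Real.rpow_add hK₀]; simp
  have hbias : 0 ≤ biasConst Uf UΘ G₀ L L₀ := by unfold biasConst; positivity
  set C := driftConst n Uf UΘ Uπ G₀ L L₀ with hC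
  have hC₀ : 0 ≤ C := by rw [hC]; unfold driftConst; positivity
  set T : ℝ := t ^ 2 + (Bk + t) with hT
  have hB' : (1 : ℝ) ≤ Bk := by exact_mod_cast hB
  have hT₁ : 1 ≤ T := by nlinarith
  have hN' : (N : ℝ) = Bk + m := by rw [hN]; push_cast; ring
  have hm₀ : (0 : ℝ) ≤ m := Nat.cast_nonneg m
  have hN₁ : 1 ≤ (N : ℝ) := by linarith
  have hNT : (N : ℝ) ≤ 2 * T := by nlinarith
  have hm₂ : ((m : ℝ) + 1) ^ 2 ≤ (t + 2) ^ 2 :=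
    pow_le_pow_left₀ (by linarith) (by linarith) 2
  -- The left side is at most `t² + 5t + Bk + 5`, and `1 ≤ Bk` absorbs the constant.
  have hNmT : (N : ℝ) + (m + 1) ^ 2 ≤ 10 * T := by nlinarith
  have hE : biasConst Uf UΘ G₀ L L₀ * (N * (Uf * G₀)) +
      n * (m + 1) * (G₀ ^ 2 * (2 * Uπ * (m * (Uf * G₀)))) + L * (Uf * G₀) ^ 2 ≤ C * (10 * T) := by
    exact (driftConst_mul_ge hUf hUΘ hUπ hG₀ hL hL₀ n hm₀ hN₁).trans
      (mul_le_mul_of_nonneg_left hNmT hC₀)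
  have hsum := sum_learningRate_le hη hr₀ hr₁ K
  have hsum₀ : 0 ≤ ∑ k ∈ Finset.Icc 1 K, learningRate η₁ r k :=
    Finset.sum_nonneg fun k _ => learningRate_nonneg hη k
  have hEsum := mul_le_mul hE hsum hsum₀ (by positivity)
  rw [inv_learningRate] at h
  have hKF : (K : ℝ) * F ≤ 2 * G₀ ^ 2 * κ₀ * z := by
    calc (K : ℝ) * F ≤ K * (2 * G₀ ^ 2 * (κ₀ * (K : ℝ) ^ (-r))) := by gcongr
      _ = 2 * G₀ ^ 2 * κ₀ * z := by
        rw [Real.rpow_neg hK₀.le, ← hy, hyz]; field_simp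
  have hNz : (N : ℝ) * (w * G₀ ^ 2) ≤ 2 * (w * G₀ ^ 2) * (T * z) := by
    calc (N : ℝ) * (w * G₀ ^ 2) ≤ 2 * T * (w * G₀ ^ 2) := by gcongr
      _ ≤ 2 * T * (w * G₀ ^ 2) * z := le_mul_of_one_le_right (by positivity) hz₁
      _ = _ := by ring
  have hFz : 2 * G₀ ^ 2 * κ₀ * z ≤ 4 * (G₀ ^ 2 * κ₀) * (T * z) := by
    calc 2 * G₀ ^ 2 * κ₀ * z ≤ 4 * (G₀ ^ 2 * κ₀) * z * 1 := by
          have : 0 ≤ G₀ ^ 2 * κ₀ * z := by positivity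
          linarith
      _ ≤ 4 * (G₀ ^ 2 * κ₀) * z * T := by gcongr
      _ = _ := by ring
  have hcoef : 0 ≤ 2 * (w * G₀ ^ 2) + 10 * (C * (η₁ * (1 - r)⁻¹)) + 4 * (G₀ ^ 2 * κ₀) := by
    have : 0 ≤ (1 - r)⁻¹ := inv_nonneg.2 hr₁'.le
    positivity
  have htot : w * s ≤ (2 * UJ * η₁⁻¹ + 2 * (w * G₀ ^ 2) +
      10 * (C * (η₁ * (1 - r)⁻¹)) + 4 * (G₀ ^ 2 * κ₀)) * (y + T * z) := by
    have i₁ : 0 ≤ 2 * UJ * η₁⁻¹ * (T * z) := by positivity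
    have i₂ := mul_nonneg hcoef hypos.le
    linarith
  have hdiv : s ≤ rateConst n Uf UΘ Uπ G₀ L L₀ κ₀ UJ η₁ r * (y + T * z) := by
    have := mul_le_mul_of_nonneg_left htot (inv_nonneg.2 hw.le)
    rwa [inv_mul_cancel_left₀ hw.ne', ← mul_assoc] at this
  calc 1 / (K : ℝ) * s ≤ 1 / (K : ℝ) * (rateConst n Uf UΘ Uπ G₀ L L₀ κ₀ UJ η₁ r * (y + T * z)) := by
        gcongr
    _ = _ := by rw [hyz, hT]; field_simp; ring

variable {d : ℕ} {S : Type u} {A : Type v} {Ω : Type w} [MeasurableSpace S] [MeasurableSpace A]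
  [mΩ : MeasurableSpace Ω]
  {M : MDP d S A} {γ : ℝ} {n : ℕ} {R : EstimatorKind} {Uf c η₁ r : ℝ} {B : ℕ → ℕ} {F₀ : Finset ℤ}
  {μ : Measure Ω} {ℱ : Filtration ℕ mΩ} {X : Run d S A Ω}
  {Ur UΘ LΘ Uπ κ₀ κ L G₀ L₀ UJ : ℝ} {dstat : Param d → Measure S} {J : Param d → ℝ}

theorem IsPGVRER.avgSqGrad_le [IsProbabilityMeasure μ]
    (hX : IsPGVRER M γ n R Uf c η₁ r B F₀ μ ℱ X) (hn : 1 ≤ n)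
    (hreg : M.Regular Ur UΘ LΘ Uπ) (herg : M.UniformlyErgodic dstat κ₀ κ)
    (hobj : M.IsObjective γ dstat UJ J) (hγ₀ : 0 ≤ γ) (hγ₁ : γ < 1) (hc : 1 ≤ c)
    (hη : 0 < η₁) (hr₀ : 0 < r) (hr₁ : r < 1) (hUf : 0 < Uf) (hUπ : 0 ≤ Uπ) (hκ₀ : 0 ≤ κ₀)
    (hκ : 0 < κ) (hκ₁ : κ < 1) (hBm : Monotone B) (hB : ∀ k, 1 ≤ B k)
    (hratio : R = EstimatorKind.LR → ∀ θ₁ θ₂ s a, M.dens θ₁ s a / M.dens θ₂ s a ≤ Uf)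
    (hJ : ∀ θ, ‖gradient J θ‖ ≤ G₀) (hg : ∀ θ x, ‖M.scenarioGrad γ θ x‖ ≤ G₀)
    (hgm : Measurable fun z : Param d × (S × A) => M.scenarioGrad γ z.1 z.2)
    (hL : ∀ θ₁ θ₂, ‖gradient J θ₁ - gradient J θ₂‖ ≤ L * ‖θ₁ - θ₂‖)
    (hL₀ : ∀ θ₁ θ₂ x, ‖M.scenarioGrad γ θ₁ x - M.scenarioGrad γ θ₂ x‖ ≤ L₀ * ‖θ₁ - θ₂‖)
    (hUΘ : 0 ≤ UΘ) (hLpos : 0 ≤ L) (hL₀pos : 0 ≤ L₀) {K : ℕ} (hK : 1 ≤ K) :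
    avgSqGrad J μ X K ≤ rateConst n Uf UΘ Uπ G₀ L L₀ κ₀ UJ η₁ r *
      (1 / (K : ℝ) ^ (1 - r) + mixingLag κ r n K ^ 2 / (K : ℝ) ^ r +
        (B K + mixingLag κ r n K) / (K : ℝ) ^ r) := by
  obtain ⟨ω₀⟩ := nonempty_of_isProbabilityMeasure μ
  have hG₀ : 0 ≤ G₀ := (norm_nonneg _).trans (hJ (X.θ 0 ω₀))
  have hUJ : 0 ≤ UJ := (abs_nonneg _).trans (hobj.abs_le (X.θ 0 ω₀))
  have ht := mixingLag_nonneg hκ hκ₁ hr₀ n hK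
  have hw : 0 < min 1 Uf := lt_min one_pos hUf
  have hbias : 0 ≤ biasConst Uf UΘ G₀ L L₀ := by unfold biasConst; positivity
  -- The same lag and the same `N` serve all `k ≤ K`, because `B k ≤ B K`.
  refine rate_of_sum_le (m := ⌈mixingLag κ r n K⌉₊) (N := B K + ⌈mixingLag κ r n K⌉₊)
    (F := 2 * G₀ ^ 2 * (κ₀ * κ ^ (n * ⌈mixingLag κ r n K⌉₊)))
    hUf hUΘ hUπ hG₀ hLpos hL₀pos hκ₀ hUJ hη hr₀ hr₁ ht
    (Nat.ceil_lt_add_one ht).le rfl (hB K) hK ?_ ?_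
  · have := pow_ceil_mixingLag_le (r := r) hκ hκ₁ hn hK
    gcongr
  · rw [Finset.mul_sum]
    refine sum_le_of_ascent (a := fun k : ℕ => ∫ ω, J (X.θ (k : ℤ) ω) ∂μ)
      (g := fun k : ℕ => ∫ ω, ‖gradient J (X.θ (k : ℤ) ω)‖ ^ 2 ∂μ) hη hr₀
      (fun k => abs_integral_le_of_abs_le fun ω => hobj.abs_le _)
      (fun k => mul_le_mul_of_nonneg_left ?_ hw.le) (by positivity) (by positivity) (by positivity)
      fun k hk hkK => ?_
    · refine (le_abs_self _).trans (abs_integral_le_of_abs_le fun ω => ?_)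
      rw [abs_of_nonneg (by positivity)]
      exact pow_le_pow_left₀ (norm_nonneg _) (hJ _) 2
    · exact hX.expected_ascent hn hreg herg hobj hγ₀ hγ₁ hc hη hr₀ hUf hUπ hκ₀ hκ.le hκ₁.le hB hratio
        hJ hg hgm hL hL₀ hUΘ hLpos hL₀pos (Nat.add_le_add_right (hBm hkK) _) hk

theorem avgSqGrad_nonneg {d : ℕ} {S A Ω : Type*} [MeasurableSpace Ω] (J : Param d → ℝ)
    (μ : Measure Ω) (X : Run d S A Ω) (K : ℕ) : 0 ≤ avgSqGrad J μ X K :=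
  mul_nonneg (by positivity) (Finset.sum_nonneg fun _ _ => integral_nonneg fun _ => by positivity)

end Rate

end VRER

/-! ### The main theorem -/

theorem corollary2
    (n : ℕ) (hn : 1 ≤ n)
    (γ : ℝ) (hγ₀ : 0 ≤ γ) (hγ₁ : γ < 1)
    (Ur UΘ LΘ Uπ : ℝ) (hUr : 0 < Ur) (hUΘ : 0 < UΘ) (hLΘ : 0 < LΘ) (hUπ : 0 < Uπ)
    (κ₀ κ : ℝ) (hκ₀ : 0 < κ₀) (hκ_pos : 0 < κ) (hκ_lt : κ < 1)
    (UJ : ℝ) (Uf : ℝ) (hUf : 0 < Uf) (c : ℝ) (hc : 1 < c)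
    (r : ℝ) (hr₀ : 0 < r) (hr₁ : r < 1) :
    -- the policy gradient is Lipschitz continuous, with a constant `L` that depends only on the
    -- constants above, so that the range of learning rates below is never empty
    (∃ L : ℝ, 0 < L ∧
      ∀ (d : ℕ) (S : Type u) (A : Type v) [MeasurableSpace S] [MeasurableSpace A]
        (M : VRER.MDP d S A) (dstat : VRER.Param d → Measure S) (J : VRER.Param d → ℝ),
        M.Regular Ur UΘ LΘ Uπ → M.UniformlyErgodic dstat κ₀ κ → M.IsObjective γ dstat UJ J →
        ∀ θ₁ θ₂, ‖gradient J θ₁ - gradient J θ₂‖ ≤ L * ‖θ₁ - θ₂‖) ∧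
    -- the rate of convergence, for each Lipschitz constant `L` and each `η₁ ∈ (0, 1/(4L)]`
    ∀ L η₁ : ℝ, 0 < L → 0 < η₁ → η₁ ≤ 1 / (4 * L) →
      ∃ C : ℝ, 0 < C ∧
        ∀ (d : ℕ) (S : Type u) (A : Type v) (Ω : Type w) [MeasurableSpace S] [MeasurableSpace A]
          [mΩ : MeasurableSpace Ω]
          (M : VRER.MDP d S A) (dstat : VRER.Param d → Measure S) (J : VRER.Param d → ℝ),
          M.Regular Ur UΘ LΘ Uπ → M.UniformlyErgodic dstat κ₀ κ → M.IsObjective γ dstat UJ J →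
          (∀ θ₁ θ₂, ‖gradient J θ₁ - gradient J θ₂‖ ≤ L * ‖θ₁ - θ₂‖) →
          ∀ R : VRER.EstimatorKind,
          -- bounded likelihood ratio; the clipped estimator needs no such bound
          (R = VRER.EstimatorKind.LR → ∀ θ₁ θ₂ s a, M.dens θ₁ s a / M.dens θ₂ s a ≤ Uf) →
          ∀ B : ℕ → ℕ, Monotone B → (∀ k, 1 ≤ B k) →
          ∀ (F₀ : Finset ℤ) (μ : Measure Ω) [IsProbabilityMeasure μ] (ℱ : Filtration ℕ mΩ)
            (X : VRER.Run d S A Ω),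
          VRER.IsPGVRER M γ n R Uf c η₁ r B F₀ μ ℱ X →
            (∀ K : ℕ, 1 ≤ K →
              VRER.avgSqGrad J μ X K ≤
                C * (1 / (K : ℝ) ^ (1 - r) + VRER.mixingLag κ r n K ^ 2 / (K : ℝ) ^ r +
                  (B K + VRER.mixingLag κ r n K) / (K : ℝ) ^ r)) ∧
            (Tendsto (fun K : ℕ => (B K : ℝ) / (K : ℝ) ^ r) atTop (𝓝 0) →
              Tendsto (fun K : ℕ => VRER.avgSqGrad J μ X K) atTop (𝓝 0)) := by 
  have hκ' : 0 < 1 - κ := sub_pos.2 hκ_lt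
  have hγ' : 0 < 1 - γ := sub_pos.2 hγ₁
  have hdisc : 0 ≤ VRER.discountSum γ := VRER.discountSum_nonneg hγ₀
  have hG₀ : 0 < VRER.MDP.gradBound γ Ur UΘ := by unfold VRER.MDP.gradBound; positivity
  have hL₀ : 0 < VRER.MDP.gradLip γ Ur UΘ LΘ Uπ := by unfold VRER.MDP.gradLip; positivity
  refine ⟨⟨VRER.MDP.policyGradLip γ Ur UΘ LΘ Uπ κ₀ κ, ?_, ?_⟩, ?_⟩
  · unfold VRER.MDP.policyGradLip; positivity
  · intro d S A _ _ M dstat J hreg herg hobj θ₁ θ₂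
    rw [hobj.gradient_eq, hobj.gradient_eq]
    exact VRER.MDP.norm_policyGrad_sub_le hreg herg hγ₀ hγ₁ hUr.le hUπ.le hκ₀.le hκ_pos.le hκ_lt θ₁ θ₂
  · intro L η₁ hL hη _
    -- The constant is chosen before any objective is given, so `UJ` has no known sign; the absolute
    -- value plus one guarantees positivity.
    refine ⟨|VRER.rateConst n Uf UΘ Uπ (VRER.MDP.gradBound γ Ur UΘ)
      L (VRER.MDP.gradLip γ Ur UΘ LΘ Uπ) κ₀ UJ η₁ r| + 1, by positivity, ?_⟩
    intro d S A Ω _ _ mΩ M dstat J hreg herg hobj hLip R hratio B hBm hB F₀ μ _ ℱ X hX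
    have hrate : ∀ K : ℕ, 1 ≤ K → VRER.avgSqGrad J μ X K ≤
        (|VRER.rateConst n Uf UΘ Uπ (VRER.MDP.gradBound γ Ur UΘ)
          L (VRER.MDP.gradLip γ Ur UΘ LΘ Uπ) κ₀ UJ η₁ r| + 1) *
        (1 / (K : ℝ) ^ (1 - r) + VRER.mixingLag κ r n K ^ 2 / (K : ℝ) ^ r +
          (B K + VRER.mixingLag κ r n K) / (K : ℝ) ^ r) := by
      intro K hK
      have ht := VRER.mixingLag_nonneg hκ_pos hκ_lt hr₀ n hK
      refine (hX.avgSqGrad_le hn hreg herg hobj hγ₀ hγ₁ hc.le hη hr₀ hr₁ hUf hUπ.le hκ₀.le hκ_pos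
        hκ_lt hBm hB hratio
        (fun θ => by
          rw [hobj.gradient_eq]
          exact VRER.MDP.norm_policyGrad_le hreg herg hγ₀ hγ₁ θ)
        (hreg.norm_scenarioGrad_le hγ₀ hγ₁)
        (hreg.measurable_uncurry_scenarioGrad hγ₀ hγ₁ hUr.le hUπ.le) hLip
        (hreg.norm_scenarioGrad_sub_le hγ₀ hγ₁ hUr.le hUπ.le) hUΘ.le hL.le hL₀.le hK).trans ?_
      refine mul_le_mul_of_nonneg_right ?_ (by positivity)
      linarith [le_abs_self (VRER.rateConst n Uf UΘ Uπ (VRER.MDP.gradBound γ Ur UΘ)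
          L (VRER.MDP.gradLip γ Ur UΘ LΘ Uπ) κ₀ UJ η₁ r)]
    refine ⟨hrate, fun hBK => ?_⟩
    refine tendsto_of_tendsto_of_tendsto_of_le_of_le' tendsto_const_nhds
      (VRER.tendsto_rate (κ := κ) (C := |VRER.rateConst n Uf UΘ Uπ (VRER.MDP.gradBound γ Ur UΘ)
          L (VRER.MDP.gradLip γ Ur UΘ LΘ Uπ) κ₀ UJ η₁ r| + 1) hr₀ hr₁ n hBK)
      (.of_forall fun K => VRER.avgSqGrad_nonneg J μ X K) ?_
    filter_upwards [eventually_ge_atTop 1] with K hK using hrate K hK
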